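/- Let $k\ge 2$ and let $R_k=\mathbb C[x,y]/(x^k)$, $\mathbb Z$-graded with $\deg x=1$, $\deg y=-1$. Let $\mathcal C=\mathrm{MCM}_{\mathbb Z}R_k$ be the category of finitely generated $\mathbb Z$-graded maximal Cohen–Macaulay $R_k$-modules with morphisms of degree $0$, and let $\mathrm{Ext}^1$ denote its extension functor (classes of short exact sequences in $\mathcal C$). For a graded module $M$ let $M(j)$ be the shift with $M(j)_n=M_{n+j}$. A $k$-subset of $\mathbb Z$ is written as a strictly increasing tuple $\underline\ell=(\ell_1<\dots<\ell_k)$ of integers. Associated to it is the rank-one module $$I(\underline\ell)=\bigl(x^{p-1}y^{\,\ell_k-\ell_p-(k-p)} : 1\le p\le k\bigr)\,(k-1-\ell_k),$$ a shifted homogeneous ideal of $R_k$, which is an object of $\mathcal C$. For $k$-subsets $\underline\ell,\underline m$ let $A(\underline\ell,\underline m)$ be the $(k\times k)$-grid whose vertex $(i,j)$ is filled if $\ell_i\le m_j$ and empty otherwise, and $B(\underline\ell,\underline m)$ the grid whose vertex $(i,j)$ is filled if $\ell_i<m_j$ and empty otherwise. For $1\le p\le k$ let $D_p^+=\{(i,j):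 j-i=k-p\}$ and $D_p^-=\{(i,j): i-j=k-p\}$, where $1\le i,j\le k$. Let $\alpha(\underline\ell,\underline m)$ be the largest $p\in\{1,\dots,k\}$ such that all vertices of $A(\underline\ell,\underline m)$ on $D_p^+$ are filled, and $\beta(\underline\ell,\underline m)$ the largest $p\in\{1,\dots,k\}$ such that all vertices of $B(\underline\ell,\underline m)$ on $D_p^-$ are empty; each of the two numbers is $0$ if there is no such $p$. **Theorem.** For any two $k$-subsets $\underline\ell,\underline m$ of $\mathbb Z$, the space $\mathrm{Ext}^1(I(\underline\ell),I(\underline m))$ is finite-dimensional over $\mathbb C$, and $$\dim_{\mathbb C}\mathrm{Ext}^1(I(\underline\ell),I(\underline m))=\alpha(\underline\ell,\underline m)+\beta(\underline\ell,\underline m)-k-|\underline\ell\cap\underline m|.$$ -/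

import Mathlib

open CategoryTheory CategoryTheory.Limits

namespace GrassmannianCategory

noncomputable section

/-! ### Internal `ℤ`-gradings given by projections -/

/-- A family of additive projections onto the parts `ℳ n` makes `M` their internal direct
sum. -/
@[reducible]
def decompositionOfProj {M σ : Type} [AddCommGroup M] [SetLike σ M]
    [AddSubgroupClass σ M] (ℳ : ℤ → σ) (p : ℤ → M → M)
    (hadd : ∀ n x y, p n (x + y) = p n x + p n y) (hmem : ∀ n x, p n x ∈ ℳ n)
    (hsame : ∀ n x, x ∈ ℳ n → p n x = x) (hne : ∀ m n x, x ∈ ℳ m → m ≠ n → p n x = 0)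
    (hsum : ∀ x, ∃ s : Finset ℤ, ∑ n ∈ s, p n x = x) : DirectSum.Decomposition ℳ :=
  DirectSum.IsInternal.chooseDecomposition ℳ (by
    constructor
    · rw [injective_iff_map_eq_zero]
      intro v hv
      have key : ∀ (n : ℤ) (v : DirectSum ℤ fun i => ℳ i),
          p n (DirectSum.coeAddMonoidHom ℳ v) = (v n : M) := by
        intro n v
        induction v using DirectSum.induction_on with
        | zero =>
          have h0 := hadd n 0 0
          simpa using h0
        | of i x =>
          rw [DirectSum.coeAddMonoidHom_of, DirectSum.coe_of_apply]
          split_ifs with hi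
          · subst hi
            exact hsame _ _ x.2
          · exact hne _ _ _ x.2 hi
        | add x y hx hy => rw [map_add, hadd, hx, hy]; simp
      ext n
      rw [← key n v, hv]
      have h0 := hadd n 0 0
      simpa using h0
    · intro x
      obtain ⟨s, hs⟩ := hsum x
      refine ⟨∑ n ∈ s, DirectSum.of (fun i => ℳ i) n ⟨p n x, hmem n x⟩, ?_⟩
      rw [map_sum]
      simpa using hs)

/-! ### The abelian category of graded modules over a commutative graded algebra -/

section GradedModules

variable {𝕜 A : Type} [CommRing 𝕜] [CommRing A] [Algebra 𝕜 A]

/-- A `ℤ`-graded module over the `ℤ`-graded algebra `A = ⨁ 𝒜 n`. -/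
structure GrMod (𝒜 : ℤ → Submodule 𝕜 A) [GradedAlgebra 𝒜] where
  carrier : Type
  [addCommGroup : AddCommGroup carrier]
  [module : Module A carrier]
  /-- the homogeneous parts -/
  deg : ℤ → AddSubgroup carrier
  [decomposition : DirectSum.Decomposition deg]
  [gradedSMul : SetLike.GradedSMul 𝒜 deg]

namespace GrMod

variable {𝒜 : ℤ → Submodule 𝕜 A} [GradedAlgebra 𝒜]

attribute [instance] addCommGroup module decomposition gradedSMul

instance : CoeSort (GrMod 𝒜) Type := ⟨GrMod.carrier⟩

/-- The homogeneous component of degree `n` of an element. -/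
def proj (M : GrMod 𝒜) (n : ℤ) (x : M) : M := (DirectSum.decompose M.deg x n : M)

section proj
variable (M : GrMod 𝒜)

theorem proj_add (n : ℤ) (x y : M) : M.proj n (x + y) = M.proj n x + M.proj n y := by
  simp [proj, DirectSum.decompose_add]

theorem proj_mem (n : ℤ) (x : M) : M.proj n x ∈ M.deg n := (DirectSum.decompose M.deg x n).2

theorem proj_same {n : ℤ} {x : M} (hx : x ∈ M.deg n) : M.proj n x = x :=
  DirectSum.decompose_of_mem_same _ hx

theorem proj_ne {m n : ℤ} {x : M} (hx : x ∈ M.deg m) (h : m ≠ n) : M.proj n x = 0 :=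
  DirectSum.decompose_of_mem_ne _ hx h

theorem proj_sum (x : M) : ∃ s : Finset ℤ, ∑ n ∈ s, M.proj n x = x := by
  classical
  exact ⟨_, DirectSum.sum_support_decompose M.deg x⟩

theorem proj_zero (n : ℤ) : M.proj n 0 = 0 := by simp [proj]

end proj

/-- Morphisms of graded modules: linear maps that preserve degrees. -/
@[ext]
structure Hom (M N : GrMod 𝒜) where
  lin : M →ₗ[A] N
  map_deg : ∀ n x, x ∈ M.deg n → lin x ∈ N.deg n

instance : Category (GrMod 𝒜) where
  Hom := Hom
  id M := ⟨LinearMap.id, fun _ _ h => h⟩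
  comp f g := ⟨g.lin.comp f.lin, fun n x h => g.map_deg n _ (f.map_deg n x h)⟩

@[ext]
theorem hom_ext {M N : GrMod 𝒜} {f g : M ⟶ N} (h : ∀ x, f.lin x = g.lin x) : f = g :=
  Hom.ext (LinearMap.ext h)

@[simp] theorem id_lin (M : GrMod 𝒜) : Hom.lin (𝟙 M) = LinearMap.id := rfl

@[simp] theorem comp_lin {M N P : GrMod 𝒜} (f : M ⟶ N) (g : N ⟶ P) :
    (f ≫ g).lin = g.lin.comp f.lin := rfl

theorem lin_proj {M N : GrMod 𝒜} (f : M ⟶ N) (n : ℤ) (x : M) :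
    f.lin (M.proj n x) = N.proj n (f.lin x) := by
  induction x using DirectSum.Decomposition.inductionOn M.deg with
  | zero => simp [proj_zero]
  | @homogeneous i m =>
    by_cases hi : i = n
    · subst hi
      rw [M.proj_same m.2, N.proj_same (f.map_deg _ _ m.2)]
    · rw [M.proj_ne m.2 hi, N.proj_ne (f.map_deg _ _ m.2) hi, map_zero]
  | add x y hx hy => rw [proj_add, map_add, map_add, proj_add, hx, hy]

section Preadditive
variable {M N : GrMod 𝒜}

theorem algebraMap_smul_mem (M : GrMod 𝒜) (c : 𝕜) {n : ℤ} {x : M} (h : x ∈ M.deg n) :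
    algebraMap 𝕜 A c • x ∈ M.deg n := by
  have h1 := SetLike.GradedSMul.smul_mem (A := 𝒜) (B := M.deg)
    (SetLike.algebraMap_mem_graded 𝒜 c) h
  simpa using h1

instance : Zero (Hom M N) := ⟨⟨0, fun n _ _ => (N.deg n).zero_mem⟩⟩
instance : Add (Hom M N) :=
  ⟨fun f g => ⟨f.lin + g.lin, fun n x h => (N.deg n).add_mem (f.map_deg n x h) (g.map_deg n x h)⟩⟩
instance : Neg (Hom M N) := ⟨fun f => ⟨-f.lin, fun n x h => (N.deg n).neg_mem (f.map_deg n x h)⟩⟩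
instance : Sub (Hom M N) :=
  ⟨fun f g => ⟨f.lin - g.lin, fun n x h => (N.deg n).sub_mem (f.map_deg n x h) (g.map_deg n x h)⟩⟩
instance : SMul ℕ (Hom M N) :=
  ⟨fun c f => ⟨c • f.lin, fun n x h => (N.deg n).nsmul_mem (f.map_deg n x h) c⟩⟩
instance : SMul ℤ (Hom M N) :=
  ⟨fun c f => ⟨c • f.lin, fun n x h => (N.deg n).zsmul_mem (f.map_deg n x h) c⟩⟩
/-- Scalars of the ground ring act through their image in the degree-zero part of `A`. -/
instance : SMul 𝕜 (Hom M N) :=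
  ⟨fun c f => ⟨algebraMap 𝕜 A c • f.lin,
    fun n x h => N.algebraMap_smul_mem c (f.map_deg n x h)⟩⟩

theorem lin_injective : Function.Injective (Hom.lin : Hom M N → (M →ₗ[A] N)) :=
  fun _ _ h => Hom.ext h

instance : AddCommGroup (Hom M N) :=
  lin_injective.addCommGroup _ rfl (fun _ _ => rfl) (fun _ => rfl) (fun _ _ => rfl)
    (fun _ _ => rfl) (fun _ _ => rfl)

instance : Module 𝕜 (Hom M N) where
  one_smul f := lin_injective (by change algebraMap 𝕜 A 1 • f.lin = f.lin; simp)
  mul_smul a b f := lin_injective (by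
    change algebraMap 𝕜 A (a * b) • f.lin = algebraMap 𝕜 A a • algebraMap 𝕜 A b • f.lin
    rw [map_mul, mul_smul])
  smul_zero a := lin_injective (smul_zero (algebraMap 𝕜 A a))
  smul_add a f g := lin_injective (smul_add (algebraMap 𝕜 A a) f.lin g.lin)
  add_smul a b f := lin_injective (by
    change algebraMap 𝕜 A (a + b) • f.lin = algebraMap 𝕜 A a • f.lin + algebraMap 𝕜 A b • f.lin
    rw [map_add, add_smul])
  zero_smul f := lin_injective (by change algebraMap 𝕜 A 0 • f.lin = 0; simp)

end Preadditive

instance : Preadditive (GrMod 𝒜) where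
  homGroup M N := inferInstanceAs (AddCommGroup (Hom M N))
  add_comp _ _ _ f f' g := lin_injective (LinearMap.comp_add f.lin f'.lin g.lin)
  comp_add _ _ _ f g g' := lin_injective (LinearMap.add_comp f.lin g'.lin g.lin)

instance : Linear 𝕜 (GrMod 𝒜) where
  homModule M N := inferInstanceAs (Module 𝕜 (Hom M N))
  smul_comp _ _ _ r f g := lin_injective (LinearMap.comp_smul g.lin (algebraMap 𝕜 A r) f.lin)
  comp_smul _ _ _ f r g := lin_injective (LinearMap.smul_comp (algebraMap 𝕜 A r) g.lin f.lin)

section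
variable {M N : GrMod 𝒜}

@[simp] theorem zero_lin : Hom.lin (0 : M ⟶ N) = 0 := rfl
@[simp] theorem add_lin (f g : M ⟶ N) : Hom.lin (f + g : M ⟶ N) = f.lin + g.lin := rfl
@[simp] theorem smul_lin (c : 𝕜) (f : M ⟶ N) :
    Hom.lin (c • f : M ⟶ N) = algebraMap 𝕜 A c • f.lin := rfl

end

/-- A homogeneous submodule with the induced grading. -/
def sub (M : GrMod 𝒜) (P : Submodule A M) (hP : ∀ n x, x ∈ P → M.proj n x ∈ P) : GrMod 𝒜 where
  carrier := P
  deg n := (M.deg n).comap P.subtype.toAddMonoidHom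
  decomposition := decompositionOfProj _ (fun n x => ⟨M.proj n x, hP n x x.2⟩)
    (fun n x y => Subtype.ext (M.proj_add n x y)) (fun n x => M.proj_mem n x)
    (fun n x h => Subtype.ext (M.proj_same h)) (fun m n x h hmn => Subtype.ext (M.proj_ne h hmn))
    (fun x => by
      obtain ⟨s, hs⟩ := M.proj_sum x
      exact ⟨s, Subtype.ext (by simpa using hs)⟩)
  gradedSMul := ⟨fun {_ _ _ _} ha hb => SetLike.GradedSMul.smul_mem (A := 𝒜) (B := M.deg) ha hb⟩

/-- The quotient by a homogeneous submodule with the induced grading. -/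
def quot (M : GrMod 𝒜) (P : Submodule A M) (hP : ∀ n x, x ∈ P → M.proj n x ∈ P) : GrMod 𝒜 where
  carrier := M ⧸ P
  deg n := (M.deg n).map P.mkQ.toAddMonoidHom
  decomposition := by
    let p (n : ℤ) : M ⧸ P →+ M ⧸ P := QuotientAddGroup.map P.toAddSubgroup P.toAddSubgroup
      { toFun := M.proj n, map_zero' := M.proj_zero n, map_add' := M.proj_add n }
      (fun x hx => hP n x hx)
    have hp (n : ℤ) (x : M) : p n (P.mkQ x) = P.mkQ (M.proj n x) := rfl
    refine decompositionOfProj _ (fun n => p n) (fun n => map_add (p n)) ?_ ?_ ?_ ?_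
    · intro n x
      obtain ⟨x, rfl⟩ := P.mkQ_surjective x
      exact ⟨_, M.proj_mem n x, rfl⟩
    · rintro n _ ⟨x, hx, rfl⟩
      exact (hp n x).trans (by rw [M.proj_same hx]; rfl)
    · rintro m n _ ⟨x, hx, rfl⟩ hmn
      exact (hp n x).trans (by rw [M.proj_ne hx hmn, map_zero])
    · intro x
      obtain ⟨x, rfl⟩ := P.mkQ_surjective x
      obtain ⟨s, hs⟩ := M.proj_sum x
      refine ⟨s, ?_⟩
      simp only [hp]
      rw [← map_sum, hs]
  gradedSMul := ⟨by
    rintro i j a _ ha ⟨x, hx, rfl⟩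
    exact ⟨a • x, SetLike.GradedSMul.smul_mem (A := 𝒜) (B := M.deg) ha hx, rfl⟩⟩

/-- The direct sum of two graded modules. -/
def prod (M N : GrMod 𝒜) : GrMod 𝒜 where
  carrier := M × N
  deg n := (M.deg n).prod (N.deg n)
  decomposition := by
    refine decompositionOfProj _ (fun n x => (M.proj n x.1, N.proj n x.2))
      (fun n x y => Prod.ext (M.proj_add n _ _) (N.proj_add n _ _))
      (fun n x => ⟨M.proj_mem n _, N.proj_mem n _⟩)
      (fun n x h => Prod.ext (M.proj_same h.1) (N.proj_same h.2))
      (fun m n x h hmn => Prod.ext (M.proj_ne h.1 hmn) (N.proj_ne h.2 hmn)) ?_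
    classical
    intro x
    refine ⟨DFinsupp.support (DirectSum.decompose M.deg x.1) ∪
      DFinsupp.support (DirectSum.decompose N.deg x.2), Prod.ext ?_ ?_⟩
    · rw [Prod.fst_sum]
      refine Eq.trans (Finset.sum_subset Finset.subset_union_left ?_).symm
        (DirectSum.sum_support_decompose M.deg x.1)
      intro n _ hn
      simpa [proj] using hn
    · rw [Prod.snd_sum]
      refine Eq.trans (Finset.sum_subset Finset.subset_union_right ?_).symm
        (DirectSum.sum_support_decompose N.deg x.2)
      intro n _ hn
      simpa [proj] using hn
  gradedSMul := ⟨fun {_ _ _ _} ha hb =>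
    ⟨SetLike.GradedSMul.smul_mem (A := 𝒜) (B := M.deg) ha hb.1,
      SetLike.GradedSMul.smul_mem (A := 𝒜) (B := N.deg) ha hb.2⟩⟩

/-- The zero module. -/
def zero : GrMod 𝒜 where
  carrier := PUnit
  deg _ := ⊤
  decomposition := decompositionOfProj _ (fun _ x => x) (fun _ _ _ => rfl) (fun _ _ => trivial)
    (fun _ _ _ => rfl) (fun _ _ _ _ _ => rfl) (fun _ => ⟨∅, rfl⟩)
  gradedSMul := ⟨fun {_ _ _ _} _ _ => trivial⟩

theorem zero_isZero : IsZero (zero : GrMod 𝒜) := by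
  rw [IsZero.iff_id_eq_zero]
  ext
  rfl

instance : HasZeroObject (GrMod 𝒜) := ⟨⟨zero, zero_isZero⟩⟩

instance : HasBinaryProducts (GrMod 𝒜) :=
  have h (M N : GrMod 𝒜) : HasLimit (pair M N) :=
    HasLimit.mk ⟨BinaryFan.mk (P := M.prod N)
        (⟨LinearMap.fst A M N, fun _ _ h => h.1⟩ : Hom (M.prod N) M)
        (⟨LinearMap.snd A M N, fun _ _ h => h.2⟩ : Hom (M.prod N) N),
      BinaryFan.IsLimit.mk _
        (fun {T} f g => (⟨LinearMap.prod f.lin g.lin,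
          fun n x h => ⟨f.map_deg n x h, g.map_deg n x h⟩⟩ : Hom T (M.prod N)))
        (fun f g => rfl) (fun f g => rfl)
        (fun f g m h1 h2 => by
          subst h1 h2
          rfl)⟩
  hasBinaryProducts_of_hasLimit_pair _

instance : HasFiniteProducts (GrMod 𝒜) := hasFiniteProducts_of_has_binary_and_terminal

/-! kernels -/

section kernel
variable {M N : GrMod 𝒜} (f : M ⟶ N)

theorem ker_homogeneous (n : ℤ) (x : M) (hx : x ∈ LinearMap.ker f.lin) :
    M.proj n x ∈ LinearMap.ker f.lin := by
  rw [LinearMap.mem_ker] at hx ⊢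
  rw [lin_proj, hx, proj_zero]

/-- The kernel of a morphism. -/
def ker : GrMod 𝒜 := M.sub (LinearMap.ker f.lin) (ker_homogeneous f)

/-- The inclusion of the kernel. -/
def kerι : ker f ⟶ M := ⟨(LinearMap.ker f.lin).subtype, fun _ _ h => h⟩

theorem kerι_comp : kerι f ≫ f = 0 := by
  ext x
  exact x.2

/-- The universal property of the kernel. -/
def kerIsLimit : IsLimit (KernelFork.ofι (kerι f) (kerι_comp f)) :=
  KernelFork.IsLimit.ofι _ _
    (fun g hg => ⟨g.lin.codRestrict _ (fun x => congrArg (fun k => Hom.lin k x) hg),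
      fun n x h => g.map_deg n x h⟩)
    (fun _ _ => rfl)
    (fun _ _ _ h => by
      subst h
      rfl)

instance : HasKernels (GrMod 𝒜) := ⟨fun f => HasLimit.mk ⟨_, kerIsLimit f⟩⟩

theorem range_homogeneous (n : ℤ) (x : N) (hx : x ∈ LinearMap.range f.lin) :
    N.proj n x ∈ LinearMap.range f.lin := by
  obtain ⟨y, rfl⟩ := hx
  exact ⟨M.proj n y, lin_proj f n y⟩

/-- The cokernel of a morphism. -/
def coker : GrMod 𝒜 := N.quot (LinearMap.range f.lin) (range_homogeneous f)

/-- The projection to the cokernel. -/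
def cokerπ : N ⟶ coker f := ⟨(LinearMap.range f.lin).mkQ, fun _ x h => ⟨x, h, rfl⟩⟩

theorem comp_cokerπ : f ≫ cokerπ f = 0 := by
  ext x
  exact (Submodule.Quotient.mk_eq_zero _).2 ⟨x, rfl⟩

/-- The universal property of the cokernel. -/
def cokerIsColimit : IsColimit (CokernelCofork.ofπ (cokerπ f) (comp_cokerπ f)) :=
  CokernelCofork.IsColimit.ofπ _ _
    (fun g hg => ⟨(LinearMap.range f.lin).liftQ g.lin (by
        rintro _ ⟨x, rfl⟩
        exact congrArg (fun k => Hom.lin k x) hg), by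
      rintro n _ ⟨x, hx, rfl⟩
      exact g.map_deg n x hx⟩)
    (fun _ _ => rfl)
    (fun _ _ _ h => by
      subst h
      ext x
      obtain ⟨x, rfl⟩ := Submodule.mkQ_surjective _ x
      rfl)

instance : HasCokernels (GrMod 𝒜) := ⟨fun f => HasColimit.mk ⟨_, cokerIsColimit f⟩⟩

theorem injective_of_mono [Mono f] : Function.Injective f.lin := by
  rw [injective_iff_map_eq_zero]
  intro x hx
  have h : kerι f = 0 := by
    rw [← cancel_mono f, kerι_comp, zero_comp]
  exact congrArg (fun k => Hom.lin k (⟨x, hx⟩ : LinearMap.ker f.lin)) h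

theorem surjective_of_epi [Epi f] : Function.Surjective f.lin := by
  intro y
  have h : cokerπ f = 0 := by
    rw [← cancel_epi f, comp_cokerπ, comp_zero]
  exact (Submodule.Quotient.mk_eq_zero _).1 (congrArg (fun k => Hom.lin k y) h)

/-- A monomorphism is the kernel of its cokernel. -/
theorem nonempty_normalMono [Mono f] : Nonempty (NormalMono f) := ⟨{
  Z := coker f
  g := cokerπ f
  w := comp_cokerπ f
  isLimit := KernelFork.IsLimit.ofι _ _
    (fun {W} g hg => by
      have hr (x : W) : g.lin x ∈ LinearMap.range f.lin :=
        (Submodule.Quotient.mk_eq_zero _).1 (congrArg (fun k => Hom.lin k x) hg)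
      let e := LinearEquiv.ofInjective f.lin (injective_of_mono f)
      refine ⟨e.symm.toLinearMap.comp (g.lin.codRestrict _ hr), fun n x h => ?_⟩
      set z : M := (e.symm.toLinearMap.comp (g.lin.codRestrict _ hr)) x with hz
      have h1 : f.lin z = g.lin x :=
        congrArg Subtype.val (e.apply_symm_apply (g.lin.codRestrict _ hr x))
      have h2 : M.proj n z = z := by
        apply injective_of_mono f
        rw [lin_proj, h1, N.proj_same (g.map_deg n x h)]
      rw [← h2]
      exact M.proj_mem n z)
    (fun {W} g hg => by
      ext x
      have hr : g.lin x ∈ LinearMap.range f.lin :=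
        (Submodule.Quotient.mk_eq_zero _).1 (congrArg (fun k => Hom.lin k x) hg)
      exact congrArg Subtype.val
        ((LinearEquiv.ofInjective f.lin (injective_of_mono f)).apply_symm_apply ⟨g.lin x, hr⟩))
    (fun {W} g hg m h => by
      rw [← cancel_mono f, h]
      ext x
      have hr : g.lin x ∈ LinearMap.range f.lin :=
        (Submodule.Quotient.mk_eq_zero _).1 (congrArg (fun k => Hom.lin k x) hg)
      exact congrArg Subtype.val
        ((LinearEquiv.ofInjective f.lin (injective_of_mono f)).apply_symm_apply
          ⟨g.lin x, hr⟩).symm) }⟩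

/-- An epimorphism is the cokernel of its kernel. -/
theorem nonempty_normalEpi [Epi f] : Nonempty (NormalEpi f) := ⟨{
  W := ker f
  g := kerι f
  w := kerι_comp f
  isColimit := by
    have key {W : GrMod 𝒜} (g : M ⟶ W) (hg : kerι f ≫ g = 0) : ∃ k : N ⟶ W, f ≫ k = g := by
      let e := f.lin.quotKerEquivOfSurjective (surjective_of_epi f)
      have hk : LinearMap.ker f.lin ≤ LinearMap.ker g.lin := fun x hx =>
        congrArg (fun k : ker f ⟶ W => Hom.lin k (⟨x, hx⟩ : LinearMap.ker f.lin)) hg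
      have he (x : M) : e.symm (f.lin x) = (LinearMap.ker f.lin).mkQ x := by
        rw [LinearEquiv.symm_apply_eq]
        rfl
      let k : N →ₗ[A] W := ((LinearMap.ker f.lin).liftQ g.lin hk).comp e.symm.toLinearMap
      have hkf (x : M) : k (f.lin x) = g.lin x := by
        change (LinearMap.ker f.lin).liftQ g.lin hk (e.symm (f.lin x)) = _
        rw [he]
        rfl
      refine ⟨⟨k, fun n y hy => ?_⟩, hom_ext hkf⟩
      obtain ⟨x, rfl⟩ := surjective_of_epi f y
      rw [← N.proj_same hy, ← lin_proj, hkf]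
      exact g.map_deg n _ (M.proj_mem n x)
    exact CokernelCofork.IsColimit.ofπ _ _
      (fun g hg => (key g hg).choose) (fun g hg => (key g hg).choose_spec)
      (fun g hg m h => by rw [← cancel_epi f, h, (key g hg).choose_spec]) }⟩

end kernel

instance : Abelian (GrMod 𝒜) where
  normalMonoOfMono f _ := nonempty_normalMono f
  normalEpiOfEpi f _ := nonempty_normalEpi f

instance : HasExt.{1} (GrMod 𝒜) := HasExt.standard _

variable (𝒜) in
/-- The graded algebra `A` as a graded module over itself. -/
def self : GrMod 𝒜 where
  carrier := A
  deg n := (𝒜 n).toAddSubgroup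
  decomposition := decompositionOfProj _ (fun n x => (DirectSum.decompose 𝒜 x n : A))
    (fun n x y => by simp [DirectSum.decompose_add])
    (fun n x => (DirectSum.decompose 𝒜 x n).2)
    (fun n x h => DirectSum.decompose_of_mem_same 𝒜 h)
    (fun m n x h hmn => DirectSum.decompose_of_mem_ne 𝒜 h hmn)
    (fun x => by
      classical
      exact ⟨_, DirectSum.sum_support_decompose 𝒜 x⟩)
  gradedSMul := ⟨fun {_ _ _ _} ha hb => SetLike.GradedMul.mul_mem (A := 𝒜) ha hb⟩

theorem self_proj (n : ℤ) (x : A) :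
    (self 𝒜).proj n x = (DirectSum.decompose 𝒜 x n : A) := by
  induction x using DirectSum.Decomposition.inductionOn 𝒜 with
  | zero =>
    refine (proj_zero (self 𝒜) n).trans ?_
    rw [DirectSum.decompose_zero]
    rfl
  | @homogeneous i m =>
    by_cases hi : i = n
    · subst hi
      rw [DirectSum.decompose_of_mem_same 𝒜 m.2]
      exact proj_same (self 𝒜) m.2
    · rw [DirectSum.decompose_of_mem_ne 𝒜 m.2 hi]
      exact proj_ne (self 𝒜) m.2 hi
  | add x y hx hy =>
    refine (proj_add (self 𝒜) n x y).trans ?_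
    rw [hx, hy, DirectSum.decompose_add]
    rfl

/-- A homogeneous ideal as a graded module. -/
def ofIdeal (I : Ideal A) (hI : I.IsHomogeneous 𝒜) : GrMod 𝒜 :=
  (self 𝒜).sub I (fun n (x : A) hx =>
    Eq.subst (motive := fun z : A => z ∈ I) (self_proj n x).symm (hI n hx))

/-- The graded shift `M(j)`, with `M(j)_n = M_{n + j}`. -/
def shift (M : GrMod 𝒜) (j : ℤ) : GrMod 𝒜 where
  carrier := M
  deg n := M.deg (n + j)
  decomposition := decompositionOfProj _ (fun n x => M.proj (n + j) x)
    (fun n => M.proj_add (n + j)) (fun n x => M.proj_mem (n + j) x)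
    (fun n x h => M.proj_same h) (fun m n x h hmn => M.proj_ne h (by omega))
    (fun x => by
      obtain ⟨s, hs⟩ := M.proj_sum x
      refine ⟨s.map (Equiv.subRight j).toEmbedding, ?_⟩
      simpa using hs)
  gradedSMul := ⟨fun {a b _ _} ha hb => by
    have h := SetLike.GradedSMul.smul_mem (A := 𝒜) (B := M.deg) ha hb
    simpa [add_assoc] using h⟩

end GrMod

end GradedModules

/-! ### The graded ring `R_k = ℂ[x, y] / (x ^ k)` -/

/-- The degrees of the variables: `x = X 0` has degree `1` and `y = X 1` has degree `-1`. -/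
def wt : Fin 2 → ℤ := ![1, -1]

/-- The ring `R_k = ℂ[x, y] / (x ^ k)`. -/
abbrev R (k : ℕ) : Type :=
  MvPolynomial (Fin 2) ℂ ⧸ Ideal.span {(MvPolynomial.X 0 : MvPolynomial (Fin 2) ℂ) ^ k}

/-- The class of `x` in `R_k`. -/
def x (k : ℕ) : R k := Ideal.Quotient.mk _ (MvPolynomial.X 0)

/-- The class of `y` in `R_k`. -/
def y (k : ℕ) : R k := Ideal.Quotient.mk _ (MvPolynomial.X 1)

/-- The homogeneous part of degree `n` of `R_k`: the classes of the weighted homogeneous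
polynomials of weighted degree `n`. -/
def grading (k : ℕ) (n : ℤ) : Submodule ℂ (R k) :=
  (MvPolynomial.weightedHomogeneousSubmodule ℂ wt n).map (Ideal.Quotient.mkₐ ℂ _).toLinearMap

theorem ideal_homogeneous (k : ℕ) (n : ℤ) (p : MvPolynomial (Fin 2) ℂ)
    (hp : p ∈ Ideal.span {(MvPolynomial.X 0 : MvPolynomial (Fin 2) ℂ) ^ k}) :
    MvPolynomial.weightedHomogeneousComponent wt n p ∈
      Ideal.span {(MvPolynomial.X 0 : MvPolynomial (Fin 2) ℂ) ^ k} := by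
  let _ := MvPolynomial.weightedGradedAlgebra ℂ wt
  have h := Ideal.homogeneous_span (MvPolynomial.weightedHomogeneousSubmodule ℂ wt)
    {(MvPolynomial.X 0 : MvPolynomial (Fin 2) ℂ) ^ k} (by
      rintro _ rfl
      exact ⟨k • wt 0, (MvPolynomial.isWeightedHomogeneous_X ℂ wt 0).pow k⟩)
  have h1 := h n hp
  rwa [← MvPolynomial.weightedDecomposition.decompose'_apply ℂ wt p n]

instance gradedAlgebra (k : ℕ) : GradedAlgebra (grading k) where
  one_mem := ⟨1, MvPolynomial.isWeightedHomogeneous_one ℂ wt, rfl⟩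
  mul_mem := by
    rintro m n _ _ ⟨p, hp, rfl⟩ ⟨q, hq, rfl⟩
    exact ⟨p * q, MvPolynomial.IsWeightedHomogeneous.mul hp hq, rfl⟩
  toDecomposition := by
    let I := Ideal.span {(MvPolynomial.X 0 : MvPolynomial (Fin 2) ℂ) ^ k}
    let _ := MvPolynomial.weightedGradedAlgebra ℂ wt
    let p (n : ℤ) : R k →+ R k := QuotientAddGroup.map I.toAddSubgroup I.toAddSubgroup
      (MvPolynomial.weightedHomogeneousComponent wt n).toAddMonoidHom
      (fun x hx => ideal_homogeneous k n x hx)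
    have hp (n : ℤ) (x : MvPolynomial (Fin 2) ℂ) : p n (Ideal.Quotient.mk I x) =
      Ideal.Quotient.mk I (MvPolynomial.weightedHomogeneousComponent wt n x) := rfl
    refine decompositionOfProj _ (fun n => p n) (fun n => map_add (p n)) ?_ ?_ ?_ ?_
    · intro n x
      obtain ⟨x, rfl⟩ := Ideal.Quotient.mk_surjective x
      exact ⟨_, MvPolynomial.weightedHomogeneousComponent_mem wt x n, rfl⟩
    · rintro n _ ⟨x, hx, rfl⟩
      refine (hp n x).trans ?_
      rw [MvPolynomial.weightedHomogeneousComponent_of_mem hx, if_pos rfl]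
      rfl
    · rintro m n _ ⟨x, hx, rfl⟩ hmn
      refine (hp n x).trans ?_
      rw [MvPolynomial.weightedHomogeneousComponent_of_mem hx, if_neg hmn.symm, map_zero]
    · intro x
      obtain ⟨x, rfl⟩ := Ideal.Quotient.mk_surjective x
      classical
      have h := DirectSum.sum_support_decompose
        (MvPolynomial.weightedHomogeneousSubmodule ℂ wt) x
      refine ⟨DFinsupp.support (DirectSum.decompose
        (MvPolynomial.weightedHomogeneousSubmodule ℂ wt) x), ?_⟩
      refine (Finset.sum_congr rfl fun n _ => hp n x).trans
        ((map_sum (Ideal.Quotient.mk I) _ _).symm.trans (congrArg _ ?_))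
      refine Eq.trans (Finset.sum_congr rfl fun n _ => ?_) h
      exact (MvPolynomial.weightedDecomposition.decompose'_apply ℂ wt x n).symm

/-! ### The Grassmannian category `MCM_ℤ R_k` and its `Ext¹` -/

/-- A graded `R_k`-module is maximal Cohen--Macaulay if it is finitely generated and
`Ext^i(M, R_k) = 0` for all `i > 0` over the (ungraded, Gorenstein) ring `R_k`. -/
def IsMCM {k : ℕ} (M : GrMod (grading k)) : Prop :=
  Module.Finite (R k) M ∧ ∀ i : ℕ, 0 < i →
    Subsingleton (Abelian.Ext (ModuleCat.of (R k) M) (ModuleCat.of (R k) (R k)) i)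

/-- The space `Ext¹(M, N)` of the category of graded maximal Cohen--Macaulay modules with the exact
structure inherited from graded modules: inside the Yoneda `Ext¹` of graded modules (morphisms of
degree zero), the subspace of the classes of short exact sequences `0 ⟶ N ⟶ E ⟶ M ⟶ 0` whose
middle term `E` is maximal Cohen--Macaulay. (For `M`, `N` in this category these classes are closed
under Baer sums and scalars, so that the span adds nothing.) -/
def ExtMCM {k : ℕ} (M N : GrMod (grading k)) : Submodule ℂ (Abelian.Ext M N 1) :=
  Submodule.span ℂ {e | ∃ (E : GrMod (grading k)) (f : N ⟶ E) (g : E ⟶ M) (w : f ≫ g = 0)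
    (h : (ShortComplex.mk f g w).ShortExact), IsMCM E ∧ h.extClass = e}

/-! ### The rank-one modules `I(ℓ)` -/

/-- For a tuple `ℓ_1 < ⋯ < ℓ_k` (indexed from `0` in the code), the ideal generated by the monomials
`x ^ (p - 1) * y ^ (ℓ_k - ℓ_p - (k - p))`, `1 ≤ p ≤ k`. The exponents of `y` are nonnegative as `ℓ`
is strictly increasing. -/
def rankOneIdeal {k : ℕ} (hk : 0 < k) (ℓ : Fin k → ℤ) : Ideal (R k) :=
  Ideal.span (Set.range fun p : Fin k =>
    x k ^ (p : ℕ) * y k ^ (ℓ ⟨k - 1, by omega⟩ - ℓ p - (k - 1 - p : ℤ)).toNat)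

theorem rankOneIdeal_isHomogeneous {k : ℕ} (hk : 0 < k) (ℓ : Fin k → ℤ) :
    (rankOneIdeal hk ℓ).IsHomogeneous (grading k) := by
  apply Ideal.homogeneous_span
  rintro _ ⟨p, rfl⟩
  have hx : x k ∈ grading k (wt 0) :=
    ⟨MvPolynomial.X 0, MvPolynomial.isWeightedHomogeneous_X ℂ wt 0, rfl⟩
  have hy : y k ∈ grading k (wt 1) :=
    ⟨MvPolynomial.X 1, MvPolynomial.isWeightedHomogeneous_X ℂ wt 1, rfl⟩
  exact ⟨_, SetLike.mul_mem_graded (SetLike.pow_mem_graded _ hx) (SetLike.pow_mem_graded _ hy)⟩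

/-- The graded module `I(ℓ)`: the ideal above, shifted by `k - 1 - ℓ_k`. -/
def rankOne {k : ℕ} (hk : 0 < k) (ℓ : Fin k → ℤ) : GrMod (grading k) :=
  (GrMod.ofIdeal (rankOneIdeal hk ℓ) (rankOneIdeal_isHomogeneous hk ℓ)).shift
    (k - 1 - ℓ ⟨k - 1, by omega⟩)

/-! ### Grids and diagonals -/

section Grid

variable {k : ℕ}

/-- The vertex `(i, j)` of the grid `A(ℓ, m)` is filled. -/
def gridA (ℓ m : Fin k → ℤ) (i j : Fin k) : Prop := ℓ i ≤ m j

/-- The vertex `(i, j)` of the grid `B(ℓ, m)` is filled. -/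
def gridB (ℓ m : Fin k → ℤ) (i j : Fin k) : Prop := ℓ i < m j

/-- The upper diagonal `D_p^+`. -/
def upperDiag (k p : ℕ) : Set (Fin k × Fin k) := {v | (v.2 : ℤ) - (v.1 : ℤ) = k - p}

/-- The lower diagonal `D_p^-`. -/
def lowerDiag (k p : ℕ) : Set (Fin k × Fin k) := {v | (v.1 : ℤ) - (v.2 : ℤ) = k - p}

open Classical in
/-- The largest `p ∈ {1, …, k}` such that `D_p^+` is completely filled in `A(ℓ, m)`, and `0` if
there is none. -/
def alpha (ℓ m : Fin k → ℤ) : ℕ :=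
  ((Finset.Icc 1 k).filter fun p => ∀ v ∈ upperDiag k p, gridA ℓ m v.1 v.2).sup id

open Classical in
/-- The largest `p ∈ {1, …, k}` such that `D_p^-` is completely empty in `B(ℓ, m)`, and `0` if
there is none. -/
def beta (ℓ m : Fin k → ℤ) : ℕ :=
  ((Finset.Icc 1 k).filter fun p => ∀ v ∈ lowerDiag k p, ¬ gridB ℓ m v.1 v.2).sup id

end Grid

end

end GrassmannianCategory

/-!
The extensions of `I(ℓ)` by `I(m)` are computed from a graded free cover of `I(ℓ)`.

The variable `y` acts on `R_k` as a nonzerodivisor: `R_k` is free over `ℂ[y]` on `1, …, x ^ (k - 1)`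
(`xBasis`), and `I(ℓ)` is free over `ℂ[y]` on its monomial generators `g_p`, which have the degrees
`ℓ_p` and satisfy `x g_p = y ^ (ℓ_{p + 1} - ℓ_p - 1) g_{p + 1}`.

*Cohen--Macaulayness.* Taking the coefficient of `x ^ (k - 1)` identifies `Hom_R(M, R_k)` with
`Hom_{ℂ[y]}(M, ℂ[y])`. So linear maps to `R_k` extend along inclusions that split over `ℂ[y]`, and
by dimension shifting `Ext^i(M, R_k) = 0` for `i > 0` if `M` is projective over `ℂ[y]`
(`subsingleton_ext`). By the long exact sequence the middle term of an extension of two such modules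
is again maximal Cohen--Macaulay, so that `ExtMCM` is all of the graded Yoneda `Ext¹`
(`extMCM_eq_top`).

*Reduction to matrices.* Let `F ⟶ I(ℓ)` be the graded free cover on the generators and `K` its
kernel. Then `Ext¹(I(ℓ), I(m))` is `Hom(K, I(m))` modulo the morphisms that extend to `F`. The
module `K` is generated by the relations `r_p = x ε_p - y ^ (ℓ_{p + 1} - ℓ_p - 1) ε_{p + 1}` of
degree `ℓ_p + 1` (`ker_combination`), and arbitrary images `t_p` of the `r_p` are allowed, subject
to one equation (`exists_linearMap_ker`): it suffices to solve `∑ f_p c_p = y ^ a φ(f)` for `c_p` in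
`R_k` and then to divide by a power of `y`. Setting `y = 1` is injective on each homogeneous part
and sends the part of degree `n` of `I(m)` onto the vectors supported where `n ≤ m_q`. In this way
`Hom(F, I(m))` becomes the space of the matrices supported in `A(ℓ, m)`, `Hom(K, I(m))` the space of
the matrices supported in `B(ℓ, m)` whose sums along the lower diagonals vanish (`range_matrixOf`),
and the restriction from `F` to `K` becomes the commutator with the regular nilpotent matrix
(`matrixOf_kerι_comp`).

*Counting.* The sums along the lower diagonals impose one condition for each diagonal that is not
empty in `B(ℓ, m)`, hence `k - β` conditions. The matrices that commute with the regular nilpotent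
matrix are the upper triangular Toeplitz matrices, and those supported in `A(ℓ, m)` form a space of
dimension `α`. As `A(ℓ, m)` has `|ℓ ∩ m|` more filled vertices than `B(ℓ, m)`, the dimension is
`|B| - (k - β) - (|A| - α) = α + β - k - |ℓ ∩ m|` (`finrank_matrices`).
-/

namespace GrassmannianCategory

noncomputable section

/-! ### The ring `R_k` as a free module over `ℂ[y]` -/

section

open Polynomial

/-- `R_k` as an algebra over `ℂ[y]`, the variable of `ℂ[X]` acting as `y`. -/
instance polyAlgebra (k : ℕ) : Algebra ℂ[X] (R k) := (Polynomial.aeval (y k)).toAlgebra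

theorem algebraMap_X (k : ℕ) : algebraMap ℂ[X] (R k) X = y k := Polynomial.aeval_X _

theorem algebraMap_C (k : ℕ) (c : ℂ) : algebraMap ℂ[X] (R k) (C c) = algebraMap ℂ (R k) c :=
  Polynomial.aeval_C _ c

instance (k : ℕ) : IsScalarTower ℂ ℂ[X] (R k) :=
  IsScalarTower.of_algebraMap_eq fun c => (algebraMap_C k c).symm

theorem x_pow_self (k : ℕ) : x k ^ k = 0 := by
  rw [x, ← map_pow]
  exact Ideal.Quotient.eq_zero_iff_mem.2 (Ideal.mem_span_singleton_self _)

theorem x_pow_eq_zero {k n : ℕ} (h : k ≤ n) : x k ^ n = 0 :=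
  pow_eq_zero_of_le h (x_pow_self k)

/-- `R_k` is generated by `x` and `y` as a `ℂ`-algebra. -/
theorem R_induction {k : ℕ} {P : R k → Prop} (hC : ∀ c, P (algebraMap ℂ (R k) c))
    (hadd : ∀ a b, P a → P b → P (a + b)) (hx : ∀ a, P a → P (a * x k))
    (hy : ∀ a, P a → P (a * y k)) (r : R k) : P r := by
  obtain ⟨r, rfl⟩ := Ideal.Quotient.mk_surjective r
  induction r using MvPolynomial.induction_on with
  | C c => exact hC c
  | add p q hp hq => rw [map_add]; exact hadd _ _ hp hq
  | mul_X p i hp =>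
    rw [map_mul]
    fin_cases i
    · exact hx _ hp
    · exact hy _ hp

/-- The map from `R_k` to `ℂ[y][x] / (x ^ k)` with `x ↦ x` and `y ↦ y`. -/
def toAdjoinRoot (k : ℕ) : R k →ₐ[ℂ] AdjoinRoot (X ^ k : ℂ[X][X]) :=
  Ideal.Quotient.liftₐ _
    (MvPolynomial.aeval ![AdjoinRoot.root _, AdjoinRoot.of (X ^ k : ℂ[X][X]) X]) (by
      intro a ha
      rw [Ideal.mem_span_singleton] at ha
      obtain ⟨b, rfl⟩ := ha
      have : (AdjoinRoot.root (X ^ k : ℂ[X][X])) ^ k = 0 := by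
        rw [← AdjoinRoot.mk_X, ← map_pow, AdjoinRoot.mk_self]
      simp [this])

theorem toAdjoinRoot_x (k : ℕ) : toAdjoinRoot k (x k) = AdjoinRoot.root _ := by
  refine (Ideal.Quotient.lift_mk _ _ _).trans ?_
  simp

theorem toAdjoinRoot_y (k : ℕ) : toAdjoinRoot k (y k) = AdjoinRoot.of _ X := by
  refine (Ideal.Quotient.lift_mk _ _ _).trans ?_
  simp

theorem toAdjoinRoot_algebraMap (k : ℕ) (s : ℂ[X]) :
    toAdjoinRoot k (algebraMap ℂ[X] (R k) s) = AdjoinRoot.of _ s := by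
  have h : (toAdjoinRoot k).comp (Polynomial.aeval (y k)) =
      AdjoinRoot.ofAlgHom ℂ (X ^ k : ℂ[X][X]) := by
    ext
    simp [toAdjoinRoot_y]
  exact DFunLike.congr_fun h s

/-- The inverse of `toAdjoinRoot`. -/
def ofAdjoinRoot (k : ℕ) : AdjoinRoot (X ^ k : ℂ[X][X]) →+* R k :=
  AdjoinRoot.lift (algebraMap ℂ[X] (R k)) (x k) (by simp [x_pow_self])

theorem ofAdjoinRoot_toAdjoinRoot (k : ℕ) (r : R k) : ofAdjoinRoot k (toAdjoinRoot k r) = r := by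
  induction r using R_induction with
  | hC c =>
    rw [← algebraMap_C, toAdjoinRoot_algebraMap, ofAdjoinRoot, AdjoinRoot.lift_of]
  | hadd a b ha hb => rw [map_add, map_add, ha, hb]
  | hx a ha => rw [map_mul, map_mul, ha, toAdjoinRoot_x, ofAdjoinRoot, AdjoinRoot.lift_root]
  | hy a ha =>
    rw [map_mul, map_mul, ha, toAdjoinRoot_y, ofAdjoinRoot, AdjoinRoot.lift_of, algebraMap_X]

theorem toAdjoinRoot_ofAdjoinRoot (k : ℕ) (r : AdjoinRoot (X ^ k : ℂ[X][X])) :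
    toAdjoinRoot k (ofAdjoinRoot k r) = r := by
  induction r using AdjoinRoot.induction_on with
  | ih p =>
    induction p using Polynomial.induction_on' with
    | add p q hp hq => simp only [map_add, hp, hq]
    | monomial n s =>
      rw [← C_mul_X_pow_eq_monomial]
      simp only [map_mul, map_pow, AdjoinRoot.mk_X, AdjoinRoot.mk_C]
      rw [ofAdjoinRoot, AdjoinRoot.lift_root, AdjoinRoot.lift_of, toAdjoinRoot_x,
        toAdjoinRoot_algebraMap]

/-- `R_k ≅ ℂ[y][x] / (x ^ k)` as `ℂ[y]`-modules. -/
def equivAdjoinRoot (k : ℕ) : AdjoinRoot (X ^ k : ℂ[X][X]) ≃ₗ[ℂ[X]] R k where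
  toFun := ofAdjoinRoot k
  invFun := toAdjoinRoot k
  map_add' := map_add _
  map_smul' s r := by
    rw [Algebra.smul_def, map_mul, RingHom.id_apply, Algebra.smul_def]
    congr 1
    exact AdjoinRoot.lift_of _
  left_inv := toAdjoinRoot_ofAdjoinRoot k
  right_inv := ofAdjoinRoot_toAdjoinRoot k

theorem equivAdjoinRoot_apply (k : ℕ) (r : AdjoinRoot (X ^ k : ℂ[X][X])) :
    equivAdjoinRoot k r = ofAdjoinRoot k r := rfl

/-- The basis `1, x, …, x ^ (k - 1)` of `R_k` over `ℂ[y]`. -/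
def xBasis (k : ℕ) : Module.Basis (Fin k) ℂ[X] (R k) :=
  ((AdjoinRoot.powerBasis' (monic_X_pow k : (X ^ k : ℂ[X][X]).Monic)).basis.reindex
    (finCongr (by simp))).map (equivAdjoinRoot k)

theorem xBasis_apply (k : ℕ) (q : Fin k) : xBasis k q = x k ^ (q : ℕ) := by
  simp only [xBasis, Module.Basis.map_apply, Module.Basis.reindex_apply, PowerBasis.basis_eq_pow,
    AdjoinRoot.powerBasis'_gen, equivAdjoinRoot_apply]
  rw [map_pow, ofAdjoinRoot, AdjoinRoot.lift_root]
  rfl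

/-- The coefficient of `x ^ q`. -/
def coeffX {k : ℕ} (q : Fin k) : R k →ₗ[ℂ[X]] ℂ[X] := (xBasis k).coord q

theorem sum_coeffX {k : ℕ} (r : R k) : ∑ q : Fin k, coeffX q r • x k ^ (q : ℕ) = r := by
  simpa [coeffX, xBasis_apply] using (xBasis k).sum_repr r

theorem coeffX_x_pow {k : ℕ} (q : Fin k) (n : ℕ) : coeffX q (x k ^ n) = if n = q then 1 else 0 := by
  by_cases hn : n < k
  · have := xBasis_apply k ⟨n, hn⟩
    simp only at this
    rw [← this, coeffX, Module.Basis.coord_apply, Module.Basis.repr_self, Finsupp.single_apply]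
    simp [Fin.ext_iff]
  · rw [x_pow_eq_zero (by omega), map_zero, if_neg (by omega)]

theorem y_pow_eq (k n : ℕ) : y k ^ n = algebraMap ℂ[X] (R k) (X ^ n) := by
  rw [map_pow, algebraMap_X]

theorem y_pow_mul {k : ℕ} (n : ℕ) (r : R k) : y k ^ n * r = (X ^ n : ℂ[X]) • r := by
  rw [Algebra.smul_def, y_pow_eq]

theorem eq_of_coeffX {k : ℕ} {r s : R k} (h : ∀ q, coeffX q r = coeffX q s) : r = s :=
  (xBasis k).ext_elem h

theorem y_pow_mul_cancel {k n : ℕ} {r s : R k} (h : y k ^ n * r = y k ^ n * s) : r = s := by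
  refine eq_of_coeffX fun q => ?_
  have := congrArg (coeffX q) h
  rw [y_pow_mul, y_pow_mul, map_smul, map_smul, smul_eq_mul, smul_eq_mul] at this
  exact mul_left_cancel₀ (pow_ne_zero _ X_ne_zero) this

/-- A `ℂ[y]`-linear map between `R_k`-modules that commutes with `x` is `R_k`-linear. -/
def linearOfX {k : ℕ} {M N : Type} [AddCommGroup M] [AddCommGroup N] [Module (R k) M]
    [Module (R k) N] [Module ℂ[X] M] [Module ℂ[X] N] [IsScalarTower ℂ[X] (R k) M]
    [IsScalarTower ℂ[X] (R k) N] (f : M →ₗ[ℂ[X]] N) (hf : ∀ v, f (x k • v) = x k • f v) :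
    M →ₗ[R k] N where
  toFun := f
  map_add' := map_add f
  map_smul' r v := by
    have hp (n : ℕ) (v : M) : f (x k ^ n • v) = x k ^ n • f v := by
      induction n with
      | zero => simp
      | succ n ih => rw [pow_succ', mul_smul, mul_smul, hf, ih]
    conv_lhs => rw [← sum_coeffX r]
    conv_rhs => rw [← sum_coeffX r]
    simp only [Finset.sum_smul, map_sum, smul_assoc, map_smul, hp, RingHom.id_apply]

end

/-! ### Maximal Cohen--Macaulay modules -/

section

open Polynomial

section Frobenius

theorem sum_shift_eq {S A M : Type} [CommRing S] [CommRing A] [Algebra S A] [AddCommGroup M]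
    [Module S M] [Module A M] {k : ℕ} (x : A) (hx : x ^ k = 0) (ψ : M →ₗ[S] S) (v : M) :
    ∑ i ∈ Finset.range k, ψ (x ^ (i + 1) • v) • x ^ (k - 1 - i) =
      ∑ i ∈ Finset.range k, ψ (x ^ i • v) • x ^ (k - 1 - i + 1) := by
  have h := (Finset.sum_range_succ (fun i => ψ (x ^ i • v) • x ^ (k - i)) k).symm.trans
    (Finset.sum_range_succ' (fun i => ψ (x ^ i • v) • x ^ (k - i)) k)
  simp only [hx, zero_smul, map_zero, Nat.sub_zero, smul_zero, add_zero] at h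
  refine Eq.trans (Finset.sum_congr rfl fun i _ => ?_) (h.symm.trans
    (Finset.sum_congr rfl fun i hi => ?_))
  · rw [Nat.sub_sub, add_comm 1 i]
  · rw [show k - 1 - i + 1 = k - i by have := Finset.mem_range.1 hi; omega]

variable {k : ℕ} {M : Type} [AddCommGroup M] [Module (R k) M] [Module ℂ[X] M]
  [IsScalarTower ℂ[X] (R k) M]

/-- The Frobenius isomorphism `Hom_{ℂ[y]}(M, ℂ[y]) ⟶ Hom_R(M, R)`, given by
`ψ ↦ (v ↦ ∑ ψ(x ^ i v) x ^ (k - 1 - i))`. It is a right inverse of the composition with the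
coefficient of `x ^ (k - 1)`. -/
def frobeniusLift (ψ : M →ₗ[ℂ[X]] ℂ[X]) : M →ₗ[R k] R k :=
  linearOfX
    (∑ i ∈ Finset.range k, (LinearMap.toSpanSingleton ℂ[X] (R k) (x k ^ (k - 1 - i))) ∘ₗ ψ ∘ₗ
      ((Algebra.lsmul ℂ[X] ℂ[X] M (x k ^ i)))) (by
    intro v
    simp only [LinearMap.sum_apply, LinearMap.comp_apply, Algebra.lsmul_coe,
      LinearMap.toSpanSingleton_apply, ← mul_smul, ← pow_succ, smul_eq_mul, Finset.mul_sum,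
      mul_smul_comm, ← pow_succ']
    exact sum_shift_eq (x k) (x_pow_self k) ψ v)

theorem frobeniusLift_apply (ψ : M →ₗ[ℂ[X]] ℂ[X]) (v : M) :
    frobeniusLift ψ v = ∑ i ∈ Finset.range k, ψ (x k ^ i • v) • x k ^ (k - 1 - i) := by
  change (∑ i ∈ Finset.range k, (LinearMap.toSpanSingleton ℂ[X] (R k) (x k ^ (k - 1 - i))) ∘ₗ ψ ∘ₗ
      ((Algebra.lsmul ℂ[X] ℂ[X] M (x k ^ i)))) v = _
  simp only [LinearMap.sum_apply, LinearMap.comp_apply, Algebra.lsmul_coe,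
    LinearMap.toSpanSingleton_apply]

theorem coeffX_last_x_pow_mul (hk : 0 < k) (i : ℕ) (hi : i < k) (r : R k) :
    coeffX ⟨k - 1, by omega⟩ (x k ^ i * r) = coeffX ⟨k - 1 - i, by omega⟩ r := by
  conv_rhs => rw [← sum_coeffX r]
  conv_lhs => rw [← sum_coeffX r]
  simp only [Finset.mul_sum, mul_smul_comm, ← pow_add, map_sum, map_smul, coeffX_x_pow]
  refine Finset.sum_congr rfl fun q _ => ?_
  congr 1
  exact if_congr (by grind) rfl rfl

theorem sum_range_coeffX (r : R k) (hk : 0 < k) :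
    ∑ i ∈ Finset.range k, coeffX ⟨k - 1, by omega⟩ (x k ^ i * r) • x k ^ (k - 1 - i) = r := by
  conv_rhs => rw [← sum_coeffX r]
  rw [← Finset.sum_range_reflect, Finset.sum_range]
  refine Finset.sum_congr rfl fun q _ => ?_
  rw [coeffX_last_x_pow_mul hk _ (by omega)]
  have : k - 1 - (k - 1 - (q : ℕ)) = q := by omega
  simp only [this]

variable {F : Type} [AddCommGroup F] [Module (R k) F] [Module ℂ[X] F]
  [IsScalarTower ℂ[X] (R k) F] [Module.Projective ℂ[X] M]

/-- The kernel of a surjection onto a module that is projective over `ℂ[y]` is a direct summand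
over `ℂ[y]`. -/
theorem exists_retraction (f : F →ₗ[R k] M) (hf : Function.Surjective f) :
    ∃ ρ : F →ₗ[ℂ[X]] LinearMap.ker f, ∀ v : LinearMap.ker f, ρ v = v := by
  obtain ⟨σ, hσ⟩ := Module.projective_lifting_property (f.restrictScalars ℂ[X]) LinearMap.id hf
  have hσ' (v : M) : f (σ v) = v := LinearMap.congr_fun hσ v
  exact ⟨{
    toFun := fun v => ⟨v - σ (f v), by simp [hσ']⟩
    map_add' := fun v w => Subtype.ext (by simp [add_sub_add_comm])
    map_smul' := fun s v => Subtype.ext (by simp [smul_sub]) },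
    fun v => Subtype.ext (by simp)⟩

theorem projective_ker [Module.Projective ℂ[X] F] (f : F →ₗ[R k] M)
    (hf : Function.Surjective f) : Module.Projective ℂ[X] (LinearMap.ker f) := by
  obtain ⟨ρ, hρ⟩ := exists_retraction f hf
  exact Module.Projective.of_split ((LinearMap.ker f).subtype.restrictScalars ℂ[X]) ρ
    (LinearMap.ext hρ)

/-- A linear map to `R_k` from the kernel of a surjection onto a module that is projective over
`ℂ[y]` extends. -/
theorem exists_extension (hk : 0 < k) (f : F →ₗ[R k] M)
    (hf : Function.Surjective f) (φ : LinearMap.ker f →ₗ[R k] R k) :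
    ∃ Φ : F →ₗ[R k] R k, ∀ v : LinearMap.ker f, Φ v = φ v := by
  obtain ⟨ρ, hρ⟩ := exists_retraction f hf
  refine ⟨frobeniusLift (coeffX (⟨k - 1, by omega⟩ : Fin k) ∘ₗ φ.restrictScalars ℂ[X] ∘ₗ ρ),
    fun v => ?_⟩
  rw [frobeniusLift_apply, ← sum_range_coeffX (φ v) hk]
  refine Finset.sum_congr rfl fun i _ => ?_
  have h := hρ (x k ^ i • v)
  rw [Submodule.coe_smul] at h
  rw [LinearMap.comp_apply, LinearMap.comp_apply, h, LinearMap.restrictScalars_apply, map_smul,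
    smul_eq_mul]

end Frobenius

instance projective_finsupp (k : ℕ) (ι : Type) : Module.Projective ℂ[X] (ι →₀ R k) :=
  have : Module.Free ℂ[X] (R k) := Module.Free.of_basis (xBasis k)
  inferInstance

/-- Over the Gorenstein ring `R_k`, a module that is projective over `ℂ[y]` has no higher
extensions by `R_k`. -/
theorem subsingleton_ext {k : ℕ} (hk : 0 < k) (n : ℕ) (M : Type) [AddCommGroup M] [Module (R k) M]
    [Module ℂ[X] M] [IsScalarTower ℂ[X] (R k) M] [Module.Projective ℂ[X] M] :
    Subsingleton (Abelian.Ext (ModuleCat.of (R k) M) (ModuleCat.of (R k) (R k)) (n + 1)) := by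
  induction n generalizing M with
  | zero =>
    let f : (M →₀ R k) →ₗ[R k] M := Finsupp.linearCombination (R k) id
    have hf : Function.Surjective f := Finsupp.linearCombination_id_surjective _ _
    have hS := LinearMap.shortExact_shortComplexKer hf
    have : Projective (ModuleCat.of (R k) (M →₀ R k)) :=
      ModuleCat.projective_of_free (M := ModuleCat.of (R k) (M →₀ R k)) Finsupp.basisSingleOne
    refine subsingleton_of_forall_eq 0 fun e => ?_
    obtain ⟨e', rfl⟩ := Abelian.Ext.contravariant_sequence_exact₃ hS _ e
      (Abelian.Ext.eq_zero_of_projective (P := ModuleCat.of (R k) (M →₀ R k)) _) (add_comm 1 0)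
    obtain ⟨φ, rfl⟩ := (Abelian.Ext.mk₀_bijective _ _).2 e'
    obtain ⟨Φ, hΦ⟩ := exists_extension hk f hf φ.hom
    have : φ = f.shortComplexKer.f ≫ ModuleCat.ofHom Φ := by
      ext v
      exact (hΦ v).symm
    rw [this, ← Abelian.Ext.mk₀_comp_mk₀, hS.extClass_comp_assoc]
  | succ n ih =>
    let f : (M →₀ R k) →ₗ[R k] M := Finsupp.linearCombination (R k) id
    have hf : Function.Surjective f := Finsupp.linearCombination_id_surjective _ _
    have hS := LinearMap.shortExact_shortComplexKer hf
    have : Projective (ModuleCat.of (R k) (M →₀ R k)) :=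
      ModuleCat.projective_of_free (M := ModuleCat.of (R k) (M →₀ R k)) Finsupp.basisSingleOne
    have : Module.Projective ℂ[X] (LinearMap.ker f) := projective_ker f hf
    have := ih (LinearMap.ker f)
    refine subsingleton_of_forall_eq 0 fun e => ?_
    obtain ⟨e', rfl⟩ := Abelian.Ext.contravariant_sequence_exact₃ hS _ e
      (Abelian.Ext.eq_zero_of_projective (P := ModuleCat.of (R k) (M →₀ R k)) _)
      (add_comm 1 (n + 1))
    rw [Subsingleton.elim e' 0, Abelian.Ext.comp_zero]

theorem projective_ideal {k : ℕ} (I : Ideal (R k)) : Module.Projective ℂ[X] I := by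
  have : Module.Free ℂ[X] (R k) := Module.Free.of_basis (xBasis k)
  have : Module.Finite ℂ[X] (R k) := Module.Finite.of_basis (xBasis k)
  exact inferInstanceAs (Module.Projective ℂ[X] (I.restrictScalars ℂ[X]))

/-- The modules `I(ℓ)` are maximal Cohen--Macaulay. -/
theorem isMCM_rankOne {k : ℕ} (hk : 0 < k) (ℓ : Fin k → ℤ) : IsMCM (rankOne hk ℓ) := by
  refine ⟨?_, fun i hi => ?_⟩
  · exact inferInstanceAs (Module.Finite (R k) (rankOneIdeal hk ℓ))
  · obtain ⟨i, rfl⟩ := Nat.exists_eq_succ_of_ne_zero hi.ne'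
    have := projective_ideal (rankOneIdeal hk ℓ)
    exact subsingleton_ext hk i (rankOneIdeal hk ℓ)

theorem shortExact_functionExact {k : ℕ} {S : ShortComplex (GrMod (grading k))}
    (hS : S.ShortExact) :
    Function.Exact S.f.lin S.g.lin := by
  intro v
  constructor
  · intro hv
    have := hS.mono_f
    have h := hS.exact.lift_f (GrMod.kerι S.g) (GrMod.kerι_comp S.g)
    exact ⟨_, congrArg (fun j => GrMod.Hom.lin j (⟨v, hv⟩ : LinearMap.ker S.g.lin)) h⟩
  · rintro ⟨v, rfl⟩
    exact LinearMap.congr_fun (congrArg GrMod.Hom.lin S.zero) v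

/-- An extension of maximal Cohen--Macaulay modules is maximal Cohen--Macaulay. -/
theorem IsMCM.of_shortExact {k : ℕ} {S : ShortComplex (GrMod (grading k))} (hS : S.ShortExact)
    (h₁ : IsMCM S.X₁) (h₃ : IsMCM S.X₃) : IsMCM S.X₂ := by
  have := hS.mono_f
  have := hS.epi_g
  have hex := shortExact_functionExact hS
  have hS' := ModuleCat.shortComplex_shortExact (ModuleCat.shortComplexOfCompEqZero S.f.lin S.g.lin
    (congrArg GrMod.Hom.lin S.zero)) hex (GrMod.injective_of_mono S.f)
    (GrMod.surjective_of_epi S.g)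
  refine ⟨?_, fun i hi => subsingleton_of_forall_eq 0 fun e => ?_⟩
  · have := h₁.1
    have := h₃.1
    exact Module.Finite.of_exact hex (GrMod.surjective_of_epi S.g)
  · have := h₁.2 i hi
    have := h₃.2 i hi
    obtain ⟨e', rfl⟩ := Abelian.Ext.contravariant_sequence_exact₂ hS' _ e (Subsingleton.elim _ _)
    rw [Subsingleton.elim e' 0, Abelian.Ext.comp_zero]

end

/-! ### Relations between the monomial generators -/

section

open Polynomial

section Relations

variable {A : Type} [CommRing A] {k : ℕ} (u v : A) (a : ℕ → ℕ)

/-- The basis vectors of `A ^ k`, indexed by natural numbers and zero from `k` on. -/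
def eps (A : Type) [CommRing A] (k : ℕ) (p : ℕ) : Fin k → A := fun i => if (i : ℕ) = p then 1 else 0

theorem eps_of_le {p : ℕ} (h : k ≤ p) : eps A k p = 0 := by
  ext i
  simp only [eps, Pi.zero_apply]
  rw [if_neg (by omega)]

theorem sum_smul_eps (f : Fin k → A) : ∑ p : Fin k, f p • eps A k p = f := by
  ext i
  simp [eps, ← Fin.ext_iff]

/-- The relation `u g_p = v ^ (a p - a (p + 1)) g_{p + 1}` between the elements
`g_p = u ^ p v ^ (a p)`. -/
def relation (k p : ℕ) : Fin k → A := u • eps A k p - v ^ (a p - a (p + 1)) • eps A k (p + 1)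

variable {a} (ha : Antitone a)
include ha

theorem sum_relation_partial (n : ℕ) :
    ∑ p ∈ Finset.range n, (u ^ (n - 1 - p) * v ^ (a 0 - a p)) • relation u v a k p =
      u ^ n • eps A k 0 - v ^ (a 0 - a n) • eps A k n := by
  induction n with
  | zero => simp
  | succ n ih =>
    rw [Finset.sum_range_succ]
    have h : ∑ p ∈ Finset.range n, (u ^ (n + 1 - 1 - p) * v ^ (a 0 - a p)) • relation u v a k p =
        u • ∑ p ∈ Finset.range n, (u ^ (n - 1 - p) * v ^ (a 0 - a p)) • relation u v a k p := by
      rw [Finset.smul_sum]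
      refine Finset.sum_congr rfl fun p hp => ?_
      have := Finset.mem_range.1 hp
      rw [smul_smul, ← mul_assoc, ← pow_succ', show n - 1 - p + 1 = n + 1 - 1 - p by omega]
    have h1 := ha (Nat.zero_le n)
    have h2 := ha (Nat.le_succ n)
    rw [h, ih, relation, show a 0 - a (n + 1) = (a 0 - a n) + (a n - a (n + 1)) by
      simp only [Nat.succ_eq_add_one] at h2; omega, pow_add, Nat.add_sub_cancel, Nat.sub_self]
    module

/-- The only relation needed between the relations: it is the telescoping expansion of
`u ^ k ε_0 = 0`. -/
theorem sum_relation (hu : u ^ k = 0) :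
    ∑ p ∈ Finset.range k, (u ^ (k - 1 - p) * v ^ (a 0 - a p)) • relation u v a k p = 0 := by
  rw [sum_relation_partial u v ha, hu, eps_of_le le_rfl, zero_smul, smul_zero, sub_zero]

/-- A solution over `A` of the equations `u c_p - v ^ (a p - a (p + 1)) c_{p + 1} = v ^ (a 0) t_p`
with `c_k = 0`. -/
theorem exists_solution (t : ℕ → A) (k : ℕ)
    (ht : ∑ p ∈ Finset.range k, u ^ (k - 1 - p) * v ^ (a 0 - a p) * t p = 0) :
    ∃ c : ℕ → A, c k = 0 ∧
      ∀ p, u * c p - v ^ (a p - a (p + 1)) * c (p + 1) = v ^ a 0 * t p := by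
  -- the solution obtained by dividing by the powers of `v` one step at a time; the hypothesis says
  -- that it ends with `c k = 0`
  refine ⟨fun n => -(v ^ a n * ∑ p ∈ Finset.range n, u ^ (n - 1 - p) * v ^ (a 0 - a p) * t p),
    by simp [ht], fun n => ?_⟩
  beta_reduce
  rw [Finset.sum_range_succ]
  have h : ∑ p ∈ Finset.range n, u ^ (n + 1 - 1 - p) * v ^ (a 0 - a p) * t p =
      u * ∑ p ∈ Finset.range n, u ^ (n - 1 - p) * v ^ (a 0 - a p) * t p := by
    rw [Finset.mul_sum]
    refine Finset.sum_congr rfl fun p hp => ?_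
    have := Finset.mem_range.1 hp
    rw [show n + 1 - 1 - p = n - 1 - p + 1 by omega]
    ring
  have h1 : v ^ a n = v ^ (a n - a (n + 1)) * v ^ a (n + 1) := by
    rw [← pow_add, Nat.sub_add_cancel (ha (Nat.le_succ n))]
  have h2 : v ^ a 0 = v ^ a n * v ^ (a 0 - a n) := by
    rw [← pow_add, Nat.add_sub_cancel' (ha (Nat.zero_le n))]
  simp only [h]
  simp only [Nat.add_sub_cancel, Nat.sub_self, pow_zero, one_mul]
  rw [h2, h1]
  ring

end Relations

section Kernel

variable {k : ℕ} (a : ℕ → ℕ)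

/-- The map `f ↦ ∑ f_p x ^ p y ^ (a p)`. -/
def combination (k : ℕ) : (Fin k → R k) →ₗ[R k] R k :=
  Fintype.linearCombination (R k) fun p : Fin k => x k ^ (p : ℕ) * y k ^ a p

theorem combination_apply (f : Fin k → R k) :
    combination a k f = ∑ p : Fin k, f p * (x k ^ (p : ℕ) * y k ^ a p) := rfl

theorem combination_eps (p : ℕ) : combination a k (eps (R k) k p) = x k ^ p * y k ^ a p := by
  rw [combination_apply]
  by_cases hp : p < k
  · rw [Finset.sum_eq_single ⟨p, hp⟩]
    · simp [eps]
    · intro b _ hb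
      simp only [eps]
      rw [if_neg (fun h => hb (Fin.ext h)), zero_mul]
    · simp
  · rw [x_pow_eq_zero (by omega), zero_mul]
    refine Finset.sum_eq_zero fun b _ => ?_
    simp only [eps]
    rw [if_neg (by omega), zero_mul]

/-- Modulo the relations, every vector has entries in `ℂ[y]`. -/
theorem exists_reduction (f : Fin k → R k) : ∃ s : Fin k → ℂ[X],
    f - (∑ p : Fin k, s p • eps (R k) k p) ∈
      Submodule.span (R k) (Set.range fun p : Fin k => relation (x k) (y k) a k p) := by
  set L := Submodule.span (R k) (Set.range fun p : Fin k => relation (x k) (y k) a k p) with hL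
  -- `T` contains the basis vectors and is stable under `x`, so that it is everything
  let T : Submodule ℂ[X] (Fin k → R k) := L.restrictScalars ℂ[X] ⊔
    Submodule.span ℂ[X] (Set.range fun p : Fin k => eps (R k) k p)
  have hε (p : ℕ) : eps (R k) k p ∈ T := by
    by_cases hp : p < k
    · exact Submodule.mem_sup_right (Submodule.subset_span ⟨⟨p, hp⟩, rfl⟩)
    · rw [eps_of_le (by omega)]
      exact zero_mem _
  have hx (v) (hv : v ∈ T) : x k • v ∈ T := by
    obtain ⟨l, hl, w, hw, rfl⟩ := Submodule.mem_sup.1 hv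
    rw [smul_add]
    refine add_mem (Submodule.mem_sup_left (L.smul_mem _ hl)) ?_
    clear hv hl
    induction hw using Submodule.span_induction with
    | mem _ h =>
      obtain ⟨p, rfl⟩ := h
      have h : x k • eps (R k) k p = relation (x k) (y k) a k p +
          (X ^ (a p - a (p + 1)) : ℂ[X]) • eps (R k) k (p + 1) := by
        rw [relation, y_pow_eq, algebraMap_smul, sub_add_cancel]
      simp only [h]
      exact add_mem (Submodule.mem_sup_left (Submodule.subset_span ⟨p, rfl⟩))
        (T.smul_mem _ (hε _))
    | zero => rw [smul_zero]; exact zero_mem _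
    | add v w _ _ hv hw => rw [smul_add]; exact add_mem hv hw
    | smul s v _ hv => rw [smul_comm]; exact T.smul_mem _ hv
  have hx' (n : ℕ) (p : ℕ) : x k ^ n • eps (R k) k p ∈ T := by
    induction n with
    | zero => rw [pow_zero, one_smul]; exact hε p
    | succ n ih =>
      have h := hx _ ih
      rwa [smul_smul, ← pow_succ'] at h
  have hf : f ∈ T := by
    rw [← sum_smul_eps f]
    refine sum_mem fun p _ => ?_
    rw [← sum_coeffX (f p), Finset.sum_smul]
    refine sum_mem fun q _ => ?_
    rw [smul_assoc]
    exact T.smul_mem _ (hx' _ _)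
  obtain ⟨l, hl, w, hw, rfl⟩ := Submodule.mem_sup.1 hf
  obtain ⟨s, rfl⟩ := (Submodule.mem_span_range_iff_exists_fun _).1 hw
  exact ⟨s, by simpa using hl⟩

variable {a} (ha : Antitone a)
include ha

theorem combination_relation (p : ℕ) : combination a k (relation (x k) (y k) a k p) = 0 := by
  rw [relation, map_sub, map_smul, map_smul, combination_eps, combination_eps, smul_eq_mul,
    smul_eq_mul]
  have h1 : y k ^ a p = y k ^ (a p - a (p + 1)) * y k ^ a (p + 1) := by
    rw [← pow_add, Nat.sub_add_cancel (ha (Nat.le_succ p))]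
  rw [h1]
  ring

/-- The relations between the `x ^ p y ^ (a p)` are generated by those between neighbours. -/
theorem ker_combination : LinearMap.ker (combination a k) =
    Submodule.span (R k) (Set.range fun p : Fin k => relation (x k) (y k) a k p) := by
  apply le_antisymm
  · intro f hf
    obtain ⟨s, hs⟩ := exists_reduction a f
    have h0 : combination a k (f - (∑ p : Fin k, s p • eps (R k) k p)) = 0 := by
      rw [← LinearMap.mem_ker]
      refine Submodule.span_le.2 ?_ hs
      rintro _ ⟨p, rfl⟩
      exact combination_relation ha p
    have h1 : ∑ p : Fin k, (s p * X ^ a p) • x k ^ (p : ℕ) = 0 := by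
      rw [map_sub, LinearMap.mem_ker.1 hf, zero_sub, neg_eq_zero, map_sum] at h0
      rw [← h0]
      refine Finset.sum_congr rfl fun p _ => ?_
      rw [LinearMap.map_smul_of_tower, combination_eps, mul_comm, mul_smul, mul_comm (x k ^ _),
        y_pow_mul, smul_comm]
    have h2 (p : Fin k) : s p = 0 := by
      have := Fintype.linearIndependent_iff.1 (xBasis k).linearIndependent (fun p => s p * X ^ a p)
        (by simpa only [xBasis_apply] using h1) p
      exact (mul_eq_zero.1 this).resolve_right (pow_ne_zero _ X_ne_zero)
    have h3 : ∑ p : Fin k, s p • eps (R k) k p = 0 :=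
      Finset.sum_eq_zero fun p _ => by rw [h2 p]; exact zero_smul ℂ[X] (eps (R k) k p)
    rwa [h3, sub_zero] at hs
  · rw [Submodule.span_le]
    rintro _ ⟨p, rfl⟩
    exact combination_relation ha p

/-- A linear map from the module of relations to an ideal is given by the images `t_p` of the
generating relations, subject to one equation. -/
theorem exists_linearMap_ker (J : Ideal (R k)) (t : Fin k → J)
    (ht : ∑ p : Fin k, x k ^ (k - 1 - p : ℕ) * y k ^ (a 0 - a p) * (t p : R k) = 0) :
    ∃ φ : LinearMap.ker (combination a k) →ₗ[R k] J,
      ∀ p : Fin k, φ ⟨relation (x k) (y k) a k p, combination_relation ha p⟩ = t p := by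
  let t' : ℕ → R k := fun p => if h : p < k then t ⟨p, h⟩ else 0
  have ht' (p : Fin k) : t' p = t p := by simp [t']
  obtain ⟨c, hck, hc⟩ := exists_solution (x k) (y k) ha t' k (by
    rw [Finset.sum_range]
    simpa only [ht'] using ht)
  let γ : (Fin k → R k) →ₗ[R k] R k := Fintype.linearCombination (R k) fun p : Fin k => c p
  have hγε (p : ℕ) (hp : p ≤ k) : γ (eps (R k) k p) = c p := by
    rcases hp.lt_or_eq with hp | rfl
    · change ∑ i : Fin k, eps (R k) k p i * c i = c p
      rw [Finset.sum_eq_single ⟨p, hp⟩]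
      · simp [eps]
      · intro b _ hb
        simp only [eps]
        rw [if_neg (fun h => hb (Fin.ext h)), zero_mul]
      · simp
    · rw [eps_of_le le_rfl, map_zero, hck]
  have hγ (p : Fin k) : γ (relation (x k) (y k) a k p) = y k ^ a 0 * t p := by
    rw [relation, map_sub, map_smul, map_smul, hγε _ (by omega), hγε _ (by omega), smul_eq_mul,
      smul_eq_mul, hc, ht']
  -- `∑ f_p c_p` lies in `y ^ (a 0) J` for every `f` in the kernel, since it does so for the
  -- generators; the map sought is its quotient by the nonzerodivisor `y ^ (a 0)`
  let μ : J →ₗ[R k] R k := (LinearMap.mulLeft (R k) (y k ^ a 0)) ∘ₗ J.subtype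
  have hμ : Function.Injective μ := fun v w h => Subtype.ext (y_pow_mul_cancel h)
  have hr (f : LinearMap.ker (combination a k)) : γ f ∈ LinearMap.range μ := by
    obtain ⟨f, hf'⟩ := f
    have hf := hf'
    rw [ker_combination ha] at hf
    change γ f ∈ _
    clear hf'
    induction hf using Submodule.span_induction with
    | mem _ h =>
      obtain ⟨p, rfl⟩ := h
      exact ⟨t p, (hγ p).symm⟩
    | zero => rw [map_zero]; exact zero_mem _
    | add v w _ _ hv hw => rw [map_add]; exact add_mem hv hw
    | smul s v _ hv => rw [map_smul]; exact Submodule.smul_mem _ _ hv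
  let e := LinearEquiv.ofInjective μ hμ
  refine ⟨e.symm.toLinearMap ∘ₗ (γ ∘ₗ (LinearMap.ker (combination a k)).subtype).codRestrict _ hr,
    fun p => ?_⟩
  rw [LinearMap.comp_apply, LinearEquiv.coe_coe, LinearEquiv.symm_apply_eq]
  exact Subtype.ext (hγ p)

end Kernel

end

/-! ### Graded free modules and extensions -/

namespace GrMod

section Free

variable {𝕜 A : Type} [CommRing 𝕜] [CommRing A] [Algebra 𝕜 A]
  {𝒜 : ℤ → Submodule 𝕜 A} [GradedAlgebra 𝒜] {ι : Type} [Fintype ι] [DecidableEq ι]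

variable (𝒜) in
/-- The graded free module on generators of degrees `d i`. -/
def free (d : ι → ℤ) : GrMod 𝒜 where
  carrier := ι → A
  deg n := AddSubgroup.pi Set.univ fun i => (𝒜 (n - d i)).toAddSubgroup
  decomposition := decompositionOfProj _
    (fun n f i => (DirectSum.decompose 𝒜 (f i) (n - d i) : A))
    (fun n f g => funext fun i => by simp [DirectSum.decompose_add])
    (fun n f i _ => (DirectSum.decompose 𝒜 (f i) (n - d i)).2)
    (fun n f h => funext fun i => DirectSum.decompose_of_mem_same 𝒜 (h i trivial))
    (fun m n f h hmn => funext fun i => DirectSum.decompose_of_mem_ne 𝒜 (h i trivial)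
      (fun h' => hmn (sub_left_injective h')))
    (fun f => by
      classical
      refine ⟨Finset.univ.biUnion fun i => (DFinsupp.support (DirectSum.decompose 𝒜 (f i))).map
        (Equiv.addRight (d i)).toEmbedding, funext fun i => ?_⟩
      rw [Finset.sum_apply]
      conv_rhs => rw [← DirectSum.sum_support_decompose 𝒜 (f i)]
      rw [← Finset.sum_subset (Finset.subset_biUnion_of_mem (fun i =>
        (DFinsupp.support (DirectSum.decompose 𝒜 (f i))).map (Equiv.addRight (d i)).toEmbedding)
        (Finset.mem_univ i))]
      · rw [Finset.sum_map]
        exact Finset.sum_congr rfl fun n _ => congrArg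
          (fun j => (DirectSum.decompose 𝒜 (f i) j : A)) (add_sub_cancel_right n (d i))
      · intro n _ hn
        simp only [Finset.mem_map_equiv, DFinsupp.mem_support_toFun, not_not] at hn
        exact congrArg Subtype.val hn)
  gradedSMul := ⟨fun {m n a f} ha hf i _ => by
    have h := SetLike.GradedMul.mul_mem (A := 𝒜) ha (hf i trivial)
    rwa [← add_sub_assoc] at h⟩

variable {d : ι → ℤ} {M : GrMod 𝒜}

/-- The generators of a graded free module. -/
def freeGen (i : ι) : free 𝒜 d := (Pi.single i 1 : ι → A)

theorem freeGen_mem_deg (i : ι) : (freeGen i : free 𝒜 d) ∈ (free 𝒜 d).deg (d i) := by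
  intro j _
  change (Pi.single i 1 : ι → A) j ∈ 𝒜 (d i - d j)
  rw [Pi.single_apply]
  split_ifs with h
  · subst h
    rw [sub_self]
    exact SetLike.GradedOne.one_mem
  · exact zero_mem _

/-- The morphism from a graded free module given by the images of the generators. -/
def freeLift (v : ι → M) (hv : ∀ i, v i ∈ M.deg (d i)) : free 𝒜 d ⟶ M :=
  ⟨Fintype.linearCombination A v, fun n f hf => by
    refine sum_mem fun i _ => ?_
    have h := SetLike.GradedSMul.smul_mem (A := 𝒜) (B := M.deg) (hf i trivial) (hv i)
    rwa [vadd_eq_add, sub_add_cancel] at h⟩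

theorem freeLift_freeGen (v : ι → M) (hv : ∀ i, v i ∈ M.deg (d i)) (i : ι) :
    (freeLift v hv).lin (freeGen i) = v i := by
  refine (Fintype.linearCombination_apply_single A v i 1).trans (one_smul A _)

theorem free_hom_ext {f g : free 𝒜 d ⟶ M}
    (h : ∀ i, f.lin (freeGen i) = g.lin (freeGen i)) : f = g :=
  lin_injective ((Pi.basisFun A ι).ext fun i => by
    rw [Pi.basisFun_apply]
    exact h i)

theorem epi_of_surjective {M N : GrMod 𝒜} (f : M ⟶ N) (hf : Function.Surjective f.lin) : Epi f :=
  ⟨fun g h hgh => hom_ext fun v => by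
    obtain ⟨w, rfl⟩ := hf v
    exact LinearMap.congr_fun (congrArg Hom.lin hgh) w⟩

theorem exists_preimage_mem_deg {M N : GrMod 𝒜} (f : M ⟶ N) (hf : Function.Surjective f.lin)
    {n : ℤ} {w : N} (hw : w ∈ N.deg n) : ∃ v ∈ M.deg n, f.lin v = w := by
  obtain ⟨v, rfl⟩ := hf w
  exact ⟨M.proj n v, M.proj_mem n v, by rw [lin_proj, N.proj_same hw]⟩

instance projective_free : Projective (free 𝒜 d) := ⟨fun {E N} f e _ => by
  choose v hv hev using fun i => exists_preimage_mem_deg e (surjective_of_epi e)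
    (f.map_deg _ _ (freeGen_mem_deg i))
  exact ⟨freeLift v hv, free_hom_ext fun i => by
    rw [comp_lin, LinearMap.comp_apply, freeLift_freeGen, hev]⟩⟩

/-- A linear map is a morphism of graded modules if its composition with a surjective morphism
preserves degrees. -/
theorem map_deg_of_surjective {P K N : GrMod 𝒜} (e : P ⟶ K) (he : Function.Surjective e.lin)
    (φ : K →ₗ[A] N) (hφ : ∀ n v, v ∈ P.deg n → φ (e.lin v) ∈ N.deg n) (n : ℤ) (w : K)
    (hw : w ∈ K.deg n) : φ w ∈ N.deg n := by
  obtain ⟨v, hv, rfl⟩ := exists_preimage_mem_deg e he hw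
  exact hφ n v hv

theorem shortExact_ker {M N : GrMod 𝒜} (f : M ⟶ N) (hf : Function.Surjective f.lin) :
    (ShortComplex.mk (kerι f) f (kerι_comp f)).ShortExact where
  exact := ShortComplex.exact_of_f_is_kernel _ (kerIsLimit f)
  mono_f := mono_of_isLimit_fork (kerIsLimit f)
  epi_g := epi_of_surjective f hf

end Free

end GrMod

section Extensions

open Abelian

variable {C : Type 1} [Category.{0} C] [Abelian C] [Linear ℂ C] [HasExt.{1} C]
  {S : ShortComplex C} (hS : S.ShortExact)

/-- The connecting map `Hom(S₁, N) ⟶ Ext¹(S₃, N)` of a short exact sequence. -/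
def connecting (N : C) : (S.X₁ ⟶ N) →ₗ[ℂ] Ext.{1} S.X₃ N 1 where
  toFun φ := hS.extClass.comp (Ext.mk₀ φ) (add_zero 1)
  map_add' φ ψ := by rw [Ext.mk₀_add, Ext.comp_add]
  map_smul' c φ := by rw [Ext.mk₀_smul, Ext.comp_smul, RingHom.id_apply]

theorem connecting_apply {N : C} (φ : S.X₁ ⟶ N) :
    connecting hS N φ = hS.extClass.comp (Ext.mk₀ φ) (add_zero 1) := rfl

theorem connecting_surjective (N : C) [Projective S.X₂] :
    Function.Surjective (connecting hS N) := fun e => by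
  obtain ⟨e', rfl⟩ := Ext.contravariant_sequence_exact₃ hS _ e (Ext.eq_zero_of_projective _)
    (add_zero 1)
  obtain ⟨φ, rfl⟩ := (Ext.mk₀_bijective _ _).2 e'
  exact ⟨φ, rfl⟩

theorem connecting_eq_zero_iff {N : C} (φ : S.X₁ ⟶ N) :
    connecting hS N φ = 0 ↔ ∃ Φ : S.X₂ ⟶ N, S.f ≫ Φ = φ := by
  constructor
  · intro h
    obtain ⟨e, he⟩ := Ext.contravariant_sequence_exact₁ hS _ (Ext.mk₀ φ) (add_zero 1) h
    obtain ⟨Φ, rfl⟩ := (Ext.mk₀_bijective _ _).2 e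
    rw [Ext.mk₀_comp_mk₀] at he
    exact ⟨Φ, (Ext.mk₀_bijective _ _).1 he⟩
  · rintro ⟨Φ, rfl⟩
    rw [connecting_apply, ← Ext.mk₀_comp_mk₀, hS.extClass_comp_assoc]

/-- The class of the pushout of a short exact sequence along `φ` is the image of `φ` under the
connecting map. -/
theorem exists_extClass_eq_connecting {N : C} (φ : S.X₁ ⟶ N) :
    ∃ (E : C) (f : N ⟶ E) (g : E ⟶ S.X₃) (w : f ≫ g = 0)
      (h : (ShortComplex.mk f g w).ShortExact), h.extClass = connecting hS N φ := by
  have := hS.mono_f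
  have := hS.epi_g
  have w : S.f ≫ S.g = φ ≫ (0 : N ⟶ S.X₃) := by rw [S.zero, comp_zero]
  have w' : pushout.inr S.f φ ≫ pushout.desc S.g 0 w = 0 := pushout.inr_desc _ _ _
  have hg : IsColimit (CokernelCofork.ofπ (pushout.desc S.g 0 w) w') :=
    CokernelCofork.IsColimit.ofπ _ _
      (fun l hl => hS.gIsCokernel.desc (CokernelCofork.ofπ (pushout.inl S.f φ ≫ l) (by
        rw [pushout.condition_assoc, hl, comp_zero])))
      (fun l hl => by
        apply pushout.hom_ext
        · rw [pushout.inl_desc_assoc]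
          exact hS.gIsCokernel.fac _ WalkingParallelPair.one
        · rw [pushout.inr_desc_assoc, zero_comp, hl])
      (fun l hl m hm => by
        rw [← cancel_epi S.g]
        have hl' : S.f ≫ pushout.inl S.f φ ≫ l = 0 := by
          rw [pushout.condition_assoc, hl, comp_zero]
        have h : S.g ≫ hS.gIsCokernel.desc (CokernelCofork.ofπ (pushout.inl S.f φ ≫ l) hl') =
          pushout.inl S.f φ ≫ l := hS.gIsCokernel.fac _ WalkingParallelPair.one
        refine Eq.trans ?_ h.symm
        rw [← hm, pushout.inl_desc_assoc])
  have h : (ShortComplex.mk (pushout.inr S.f φ) (pushout.desc S.g 0 w) w').ShortExact :=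
    { exact := ShortComplex.exact_of_g_is_cokernel _ hg
      mono_f := inferInstanceAs (Mono (pushout.inr S.f φ))
      epi_g := epi_of_isColimit_cofork hg }
  refine ⟨_, _, _, w', h, ?_⟩
  let τ : S ⟶ ShortComplex.mk (pushout.inr S.f φ) (pushout.desc S.g 0 w) w' :=
    { τ₁ := φ
      τ₂ := pushout.inl S.f φ
      τ₃ := 𝟙 _
      comm₁₂ := pushout.condition.symm
      comm₂₃ := (pushout.inl_desc _ _ _).trans (Category.comp_id _).symm }
  have := ShortComplex.ShortExact.extClass_naturality hS h τ
  rw [connecting_apply]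
  exact ((this.trans (Ext.mk₀_id_comp _))).symm

end Extensions

/-- Extensions of maximal Cohen--Macaulay modules have a maximal Cohen--Macaulay middle term. -/
theorem extMCM_eq_top {k : ℕ} {M N : GrMod (grading k)} (hM : IsMCM M) (hN : IsMCM N)
    {F : GrMod (grading k)} [Projective F] (p : F ⟶ M) (hp : Function.Surjective p.lin) :
    ExtMCM M N = ⊤ := by
  refine eq_top_iff.2 fun e _ => Submodule.subset_span ?_
  have hS := GrMod.shortExact_ker p hp
  obtain ⟨φ, rfl⟩ := connecting_surjective hS N e
  obtain ⟨E, f, g, w, h, he⟩ := exists_extClass_eq_connecting hS φ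
  exact ⟨E, f, g, w, h, IsMCM.of_shortExact h hN hM, he⟩

/-! ### Matrices supported in the grids -/

/-- The functions that vanish outside `P`. -/
def suppOn {ι : Type} (P : ι → Prop) : Submodule ℂ (ι → ℂ) where
  carrier := {f | ∀ i, ¬ P i → f i = 0}
  add_mem' hf hg i hi := by simp [hf i hi, hg i hi]
  zero_mem' _ _ := rfl
  smul_mem' c f hf i hi := by simp [hf i hi]

theorem finrank_suppOn {ι : Type} [Finite ι] (P : ι → Prop) :
    Module.finrank ℂ (suppOn P) = Nat.card {i // P i} := by
  classical
  have := Fintype.ofFinite ι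
  let e : suppOn P ≃ₗ[ℂ] ({i // P i} → ℂ) :=
    { toFun := fun f i => f.1 i
      map_add' := fun _ _ => rfl
      map_smul' := fun _ _ => rfl
      invFun := fun g => ⟨fun i => if h : P i then g ⟨i, h⟩ else 0, fun i hi => dif_neg hi⟩
      left_inv := fun f => Subtype.ext (funext fun i => by
        by_cases h : P i
        · simp [h]
        · simp [h, f.2 i h])
      right_inv := fun g => funext fun i => by simp [i.2] }
  rw [e.finrank_eq, Module.finrank_fintype_fun_eq_card, Nat.card_eq_fintype_card]

/-- A nonempty initial segment of `{1, …, k}` has as many elements as its maximum says. -/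
theorem card_eq_sup_of_initial {s : Finset ℕ} (h1 : ∀ p ∈ s, 1 ≤ p)
    (h2 : ∀ p ∈ s, ∀ q, 1 ≤ q → q ≤ p → q ∈ s) : s.card = s.sup id := by
  rcases s.eq_empty_or_nonempty with rfl | hs
  · simp
  · obtain ⟨p, hp, hps⟩ := Finset.exists_mem_eq_sup s hs id
    have : s = Finset.Icc 1 (s.sup id) := by
      ext q
      rw [Finset.mem_Icc]
      exact ⟨fun hq => ⟨h1 q hq, Finset.le_sup (f := id) hq⟩,
        fun hq => h2 p hp q hq.1 (by rw [hps] at hq; exact hq.2)⟩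
    conv_lhs => rw [this]
    simp

theorem card_filter_succ (k : ℕ) (P : ℕ → Prop) [DecidablePred P] :
    Nat.card {r : Fin k // P (r + 1)} = ((Finset.Icc 1 k).filter P).card := by
  rw [Nat.card_eq_fintype_card, Fintype.card_subtype]
  refine Finset.card_bij (fun r _ => (r : ℕ) + 1) ?_ ?_ ?_
  · intro r hr
    rw [Finset.mem_filter] at hr ⊢
    exact ⟨Finset.mem_Icc.2 ⟨by omega, by omega⟩, hr.2⟩
  · intro r _ s _ h
    exact Fin.ext (by omega)
  · intro p hp
    rw [Finset.mem_filter, Finset.mem_Icc] at hp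
    exact ⟨⟨p - 1, by omega⟩, by
      rw [Finset.mem_filter]
      refine ⟨Finset.mem_univ _, ?_⟩
      simpa only [Nat.sub_add_cancel hp.1.1] using hp.2, Nat.sub_add_cancel hp.1.1⟩

theorem mem_upperDiag {k p : ℕ} {v : Fin k × Fin k} :
    v ∈ upperDiag k p ↔ (v.2 : ℤ) - (v.1 : ℤ) = k - p := Iff.rfl

theorem mem_lowerDiag {k p : ℕ} {v : Fin k × Fin k} :
    v ∈ lowerDiag k p ↔ (v.1 : ℤ) - (v.2 : ℤ) = k - p := Iff.rfl

section Counts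

variable {k : ℕ} {ℓ m : Fin k → ℤ}

/-- Exactly `α` upper diagonals are filled in `A(ℓ, m)`: if `D_p^+` is filled, then so are the
shorter diagonals. -/
theorem card_upperDiag_filled (hm : StrictMono m) :
    Nat.card {r : Fin k // ∀ v ∈ upperDiag k (r + 1), gridA ℓ m v.1 v.2} = alpha ℓ m := by
  classical
  refine (card_filter_succ k fun p => ∀ v ∈ upperDiag k p, gridA ℓ m v.1 v.2).trans ?_
  refine (card_eq_sup_of_initial ?_ ?_).trans (by rw [alpha])
  · intro p hp
    exact (Finset.mem_Icc.1 (Finset.mem_filter.1 hp).1).1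
  · intro p hp q hq hqp
    rw [Finset.mem_filter, Finset.mem_Icc] at hp ⊢
    refine ⟨⟨hq, by omega⟩, ?_⟩
    rintro ⟨i, j⟩ hij
    rw [mem_upperDiag] at hij
    simp only at hij
    have h := hp.2 (i, ⟨j - (p - q), by omega⟩) (by
      rw [mem_upperDiag]
      simp only
      omega)
    exact le_trans h (hm.monotone (Fin.le_def.2 (by simp)))

/-- Exactly `k - β` lower diagonals have a filled vertex in `B(ℓ, m)`: if `D_p^-` has one, then so
do the longer diagonals. -/
theorem card_lowerDiag_filled (hℓ : StrictMono ℓ) :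
    Nat.card {r : Fin k // ∃ v ∈ lowerDiag k (r + 1), gridB ℓ m v.1 v.2} + beta ℓ m = k := by
  classical
  have h : Nat.card {r : Fin k // ¬ ∃ v ∈ lowerDiag k (r + 1), gridB ℓ m v.1 v.2} =
      beta ℓ m := by
    simp only [not_exists, not_and]
    refine (card_filter_succ k fun p => ∀ v ∈ lowerDiag k p, ¬ gridB ℓ m v.1 v.2).trans ?_
    refine (card_eq_sup_of_initial ?_ ?_).trans (by rw [beta])
    · intro p hp
      exact (Finset.mem_Icc.1 (Finset.mem_filter.1 hp).1).1
    · intro p hp q hq hqp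
      rw [Finset.mem_filter, Finset.mem_Icc] at hp ⊢
      refine ⟨⟨hq, by omega⟩, ?_⟩
      rintro ⟨i, j⟩ hij hB
      rw [mem_lowerDiag] at hij
      simp only at hij
      refine hp.2 (⟨i - (p - q), by omega⟩, j) (by
        rw [mem_lowerDiag]
        simp only
        omega) (lt_of_le_of_lt ?_ hB)
      exact hℓ.monotone (Fin.le_def.2 (by simp))
  rw [← h, ← Nat.card_sum]
  exact (Nat.card_congr (Equiv.sumCompl _)).trans (Nat.card_fin k)

theorem card_gridA_eq (hℓ : StrictMono ℓ) (hm : StrictMono m) :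
    Nat.card {v : Fin k × Fin k // gridA ℓ m v.1 v.2} =
      Nat.card {v : Fin k × Fin k // gridB ℓ m v.1 v.2} +
        (Finset.univ.image ℓ ∩ Finset.univ.image m).card := by
  simp only [gridA, gridB, Nat.card_eq_fintype_card, Fintype.card_subtype]
  have h1 : (Finset.univ.filter fun v : Fin k × Fin k => ℓ v.1 ≤ m v.2) =
      (Finset.univ.filter fun v : Fin k × Fin k => ℓ v.1 < m v.2) ∪
        (Finset.univ.filter fun v : Fin k × Fin k => ℓ v.1 = m v.2) := by
    ext v
    simp [le_iff_lt_or_eq]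
  rw [h1, Finset.card_union_of_disjoint]
  · congr 1
    refine Finset.card_bij (fun v _ => ℓ v.1) ?_ ?_ ?_
    · intro v hv
      have hv := (Finset.mem_filter.1 hv).2
      rw [Finset.mem_inter]
      exact ⟨Finset.mem_image_of_mem _ (Finset.mem_univ _),
        Finset.mem_image.2 ⟨v.2, Finset.mem_univ _, hv.symm⟩⟩
    · intro v hv w hw h
      have hv := (Finset.mem_filter.1 hv).2
      have hw := (Finset.mem_filter.1 hw).2
      exact Prod.ext (hℓ.injective h) (hm.injective (by rw [← hv, ← hw, h]))
    · intro n hn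
      rw [Finset.mem_inter, Finset.mem_image, Finset.mem_image] at hn
      obtain ⟨⟨i, _, rfl⟩, j, _, hj⟩ := hn
      exact ⟨(i, j), Finset.mem_filter.2 ⟨Finset.mem_univ _, hj.symm⟩, rfl⟩
  · rw [Finset.disjoint_filter]
    intro v _ hv hv'
    exact hv.ne hv'

end Counts

section Matrices

variable {k : ℕ}

/-- The sums along the lower diagonals of a matrix: the entry at `r` is the sum over
`D_{r + 1}^-`. -/
def diagSum (k : ℕ) : (Fin k × Fin k → ℂ) →ₗ[ℂ] (Fin k → ℂ) where
  toFun θ r := ∑ p : Fin k, ∑ j : Fin k, if (j : ℕ) + (k - 1 - p) = r then θ (p, j) else 0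
  map_add' θ θ' := by
    ext r
    simp only [Pi.add_apply, ← Finset.sum_add_distrib]
    refine Finset.sum_congr rfl fun p _ => Finset.sum_congr rfl fun j _ => ?_
    split_ifs <;> simp
  map_smul' c θ := by
    ext r
    simp only [Pi.smul_apply, smul_eq_mul, Finset.mul_sum, RingHom.id_apply]
    refine Finset.sum_congr rfl fun p _ => Finset.sum_congr rfl fun j _ => ?_
    split_ifs <;> simp

theorem diagSum_apply (θ : Fin k × Fin k → ℂ) (r : Fin k) : diagSum k θ r =
    ∑ p : Fin k, ∑ j : Fin k, if (j : ℕ) + (k - 1 - p) = r then θ (p, j) else 0 := rfl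

/-- The commutator of a matrix with the regular nilpotent matrix: the map
`h ↦ (h_{p, q - 1} - h_{p + 1, q})`, entries outside of the matrix being zero. -/
def shiftDiff (k : ℕ) : (Fin k × Fin k → ℂ) →ₗ[ℂ] (Fin k × Fin k → ℂ) where
  toFun h v := (∑ j : Fin k, if (j : ℕ) + 1 = v.2 then h (v.1, j) else 0) -
    ∑ i : Fin k, if (i : ℕ) = v.1 + 1 then h (i, v.2) else 0
  map_add' h h' := by
    ext v
    simp only [Pi.add_apply]
    rw [← add_sub_add_comm, ← Finset.sum_add_distrib, ← Finset.sum_add_distrib]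
    congr 1 <;> refine Finset.sum_congr rfl fun p _ => ?_ <;> split_ifs <;> simp
  map_smul' c h := by
    ext v
    simp only [Pi.smul_apply, smul_eq_mul, mul_sub, Finset.mul_sum, RingHom.id_apply]
    congr 1 <;> refine Finset.sum_congr rfl fun p _ => ?_ <;> split_ifs <;> simp

theorem shiftDiff_apply (h : Fin k × Fin k → ℂ) (v : Fin k × Fin k) : shiftDiff k h v =
    (∑ j : Fin k, if (j : ℕ) + 1 = v.2 then h (v.1, j) else 0) -
      ∑ i : Fin k, if (i : ℕ) = v.1 + 1 then h (i, v.2) else 0 := rfl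

theorem diagSum_single (v : Fin k × Fin k) (r : Fin k) (h : v ∈ lowerDiag k (r + 1)) :
    diagSum k (Pi.single v 1) = Pi.single r 1 := by
  ext s
  rw [mem_lowerDiag] at h
  rw [diagSum_apply, Finset.sum_eq_single v.1, Finset.sum_eq_single v.2]
  · rw [Pi.single_eq_same, Pi.single_apply]
    refine if_congr ?_ rfl rfl
    rw [Fin.ext_iff]
    omega
  · intro j _ hj
    rw [Pi.single_eq_of_ne (fun h => hj (congrArg Prod.snd h)), ite_self]
  · simp
  · intro p _ hp
    refine Finset.sum_eq_zero fun j _ => ?_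
    rw [Pi.single_eq_of_ne (fun h => hp (congrArg Prod.fst h)), ite_self]
  · simp

theorem map_diagSum (B : Fin k × Fin k → Prop) : (suppOn B).map (diagSum k) =
    suppOn fun r : Fin k => ∃ v ∈ lowerDiag k (r + 1), B v := by
  apply le_antisymm
  · rintro _ ⟨θ, hθ, rfl⟩ r hr
    rw [diagSum_apply]
    refine Finset.sum_eq_zero fun p _ => Finset.sum_eq_zero fun j _ => ?_
    split_ifs with h
    · refine hθ _ fun hB => hr ⟨(p, j), ?_, hB⟩
      simp only [mem_lowerDiag]
      omega
    · rfl
  · intro u hu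
    have hsum : u = ∑ r, u r • (Pi.single r 1 : Fin k → ℂ) := by
      ext s
      simp [Finset.sum_apply, Pi.single_apply]
    rw [hsum]
    refine sum_mem fun r _ => ?_
    by_cases hr : ∃ v ∈ lowerDiag k (r + 1), B v
    · obtain ⟨v, hv, hB⟩ := hr
      refine Submodule.smul_mem _ _ ⟨Pi.single v 1, ?_, ?_⟩
      · intro w hw
        refine Pi.single_eq_of_ne (fun h => hw ?_) _
        rwa [h]
      · rw [diagSum_single v r hv]
    · rw [hu r hr, zero_smul]
      exact zero_mem _

/-- The upper triangular Toeplitz matrix with the value `u r` on `D_{r + 1}^+`. -/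
def toeplitz (k : ℕ) : (Fin k → ℂ) →ₗ[ℂ] (Fin k × Fin k → ℂ) where
  toFun u v := ∑ r : Fin k, if (v.1 : ℕ) + (k - 1 - r) = v.2 then u r else 0
  map_add' u u' := by
    ext v
    simp only [Pi.add_apply, ← Finset.sum_add_distrib]
    refine Finset.sum_congr rfl fun p _ => ?_
    split_ifs <;> simp
  map_smul' c u := by
    ext v
    simp only [Pi.smul_apply, smul_eq_mul, Finset.mul_sum, RingHom.id_apply]
    refine Finset.sum_congr rfl fun p _ => ?_
    split_ifs <;> simp

theorem toeplitz_apply (u : Fin k → ℂ) (v : Fin k × Fin k) : toeplitz k u v =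
    ∑ r : Fin k, if (v.1 : ℕ) + (k - 1 - r) = v.2 then u r else 0 := rfl

theorem toeplitz_of_mem (u : Fin k → ℂ) {v : Fin k × Fin k} {r : Fin k}
    (h : v ∈ upperDiag k (r + 1)) : toeplitz k u v = u r := by
  rw [mem_upperDiag] at h
  rw [toeplitz_apply, Finset.sum_eq_single r, if_pos (by omega)]
  · intro s _ hs
    refine if_neg fun h' => hs (Fin.ext (by omega))
  · simp

theorem toeplitz_of_lt (u : Fin k → ℂ) {v : Fin k × Fin k} (h : v.2 < v.1) :
    toeplitz k u v = 0 := by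
  rw [toeplitz_apply]
  refine Finset.sum_eq_zero fun r _ => if_neg ?_
  have := Fin.lt_def.1 h
  omega

theorem exists_upperDiag {v : Fin k × Fin k} (h : v.1 ≤ v.2) :
    ∃ r : Fin k, v ∈ upperDiag k (r + 1) := by
  have := Fin.le_def.1 h
  refine ⟨⟨k - 1 - (v.2 - v.1), by omega⟩, ?_⟩
  simp only [mem_upperDiag]
  omega

theorem toeplitz_injective : Function.Injective (toeplitz k) := fun u u' h => by
  ext r
  have hr : ((⟨0, r.pos⟩, ⟨k - 1 - r, by omega⟩) : Fin k × Fin k) ∈ upperDiag k (r + 1) := by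
    simp only [mem_upperDiag]
    omega
  rw [← toeplitz_of_mem u hr, h, toeplitz_of_mem u' hr]

/-- The centralizer of the regular nilpotent matrix consists of the Toeplitz matrices. -/
theorem shiftDiff_eq_zero_iff (h : Fin k × Fin k → ℂ) : shiftDiff k h = 0 ↔
    ∃ u, toeplitz k u = h := by
  constructor
  · intro hh
    have h1 (p q : ℕ) (hp : p + 1 < k) (hq : q + 1 < k) :
        h (⟨p + 1, hp⟩, ⟨q + 1, hq⟩) = h (⟨p, by omega⟩, ⟨q, by omega⟩) := by
      have h2 := congrFun hh (⟨p, by omega⟩, ⟨q + 1, hq⟩)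
      rw [shiftDiff_apply, Finset.sum_eq_single (⟨q, by omega⟩ : Fin k),
        Finset.sum_eq_single (⟨p + 1, hp⟩ : Fin k), if_pos rfl, if_pos rfl, Pi.zero_apply,
        sub_eq_zero] at h2
      · exact h2.symm
      · intro i _ hi
        exact if_neg fun h => hi (Fin.ext h)
      · simp
      · intro i _ hi
        exact if_neg fun h => hi (Fin.ext (Nat.succ_injective h))
      · simp
    have h0 (p : ℕ) (hp : p + 1 < k) : h (⟨p + 1, hp⟩, ⟨0, by omega⟩) = 0 := by
      have h2 := congrFun hh (⟨p, by omega⟩, ⟨0, by omega⟩)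
      rw [shiftDiff_apply, Finset.sum_eq_zero, Finset.sum_eq_single (⟨p + 1, hp⟩ : Fin k),
        if_pos rfl, Pi.zero_apply, zero_sub, neg_eq_zero] at h2
      · exact h2
      · intro i _ hi
        exact if_neg fun h => hi (Fin.ext h)
      · simp
      · intro i _
        exact if_neg (by simp)
    have h3 (p q : ℕ) (hp : p < k) (hq : q < k) : h (⟨p, hp⟩, ⟨q, hq⟩) =
        if p ≤ q then h (⟨0, by omega⟩, ⟨q - p, by omega⟩) else 0 := by
      induction p generalizing q with
      | zero => simp
      | succ p ih =>
        cases q with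
        | zero => rw [h0 p hp, if_neg (by omega)]
        | succ q =>
          rw [h1 p q hp hq, ih q (by omega) (by omega)]
          simp only [add_le_add_iff_right, Nat.reduceSubDiff]
    refine ⟨fun r => h (⟨0, r.pos⟩, ⟨k - 1 - r, by omega⟩), ?_⟩
    ext ⟨p, q⟩
    rcases le_or_gt p q with hpq | hpq
    · obtain ⟨r, hr⟩ := exists_upperDiag (v := (p, q)) hpq
      rw [toeplitz_of_mem _ hr, h3 p q p.2 q.2, if_pos (Fin.le_def.1 hpq)]
      rw [mem_upperDiag] at hr
      simp only at hr
      congr 3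
      omega
    · rw [toeplitz_of_lt _ hpq, h3 p q p.2 q.2, if_neg (by have := Fin.lt_def.1 hpq; omega)]
  · rintro ⟨u, rfl⟩
    ext ⟨p, q⟩
    rw [shiftDiff_apply, Pi.zero_apply, sub_eq_zero]
    rcases q with ⟨_ | q, hq⟩
    · rw [Finset.sum_eq_zero, Finset.sum_eq_zero]
      · intro i _
        split_ifs with h
        · refine toeplitz_of_lt u (Fin.lt_def.2 ?_)
          simp only at h ⊢
          omega
        · rfl
      · intro j _
        exact if_neg (by simp)
    · rw [Finset.sum_eq_single (⟨q, by omega⟩ : Fin k)]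
      · rw [if_pos rfl]
        by_cases hp : (p : ℕ) + 1 < k
        · rw [Finset.sum_eq_single (⟨p + 1, hp⟩ : Fin k)]
          · rw [if_pos rfl, toeplitz_apply, toeplitz_apply]
            refine Finset.sum_congr rfl fun r _ => if_congr ?_ rfl rfl
            simp only
            omega
          · intro i _ hi
            exact if_neg fun h => hi (Fin.ext h)
          · simp
        · rw [Finset.sum_eq_zero]
          · refine toeplitz_of_lt u (Fin.lt_def.2 ?_)
            simp only
            omega
          · intro i _
            refine if_neg ?_
            simp only
            omega
      · intro i _ hi
        exact if_neg fun h => hi (Fin.ext (Nat.succ_injective h))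
      · simp

theorem suppOn_inf_ker_shiftDiff (A : Fin k × Fin k → Prop) :
    suppOn A ⊓ LinearMap.ker (shiftDiff k) =
      (suppOn fun r : Fin k => ∀ v ∈ upperDiag k (r + 1), A v).map (toeplitz k) := by
  ext h
  rw [Submodule.mem_inf, LinearMap.mem_ker, shiftDiff_eq_zero_iff]
  constructor
  · rintro ⟨hA, u, rfl⟩
    refine ⟨u, fun r hr => ?_, rfl⟩
    push Not at hr
    obtain ⟨v, hv, hAv⟩ := hr
    rw [← toeplitz_of_mem u hv]
    exact hA v hAv
  · rintro ⟨u, hu, rfl⟩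
    refine ⟨fun v hv => ?_, u, rfl⟩
    rcases le_or_gt v.1 v.2 with h | h
    · obtain ⟨r, hr⟩ := exists_upperDiag h
      rw [toeplitz_of_mem u hr]
      exact hu r fun h' => hv (h' v hr)
    · exact toeplitz_of_lt u h

/-- Rank-nullity for the restriction of a linear map to a submodule. -/
theorem finrank_map_add_finrank_inf_ker {V W : Type} [AddCommGroup V] [Module ℂ V]
    [AddCommGroup W] [Module ℂ W] [FiniteDimensional ℂ V] (f : V →ₗ[ℂ] W) (P : Submodule ℂ V) :
    Module.finrank ℂ (P.map f) + Module.finrank ℂ ↑(P ⊓ LinearMap.ker f) =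
      Module.finrank ℂ P := by
  rw [← LinearMap.finrank_range_add_finrank_ker (f.domRestrict P), LinearMap.range_domRestrict,
    LinearMap.ker_domRestrict, ← Submodule.map_comap_subtype,
    ← (Submodule.equivMapOfInjective _ P.injective_subtype _).finrank_eq]

end Matrices

/-- The dimension of the space of matrices supported in `B(ℓ, m)` with vanishing sums along the
lower diagonals, modulo the commutators of the matrices supported in `A(ℓ, m)`. -/
theorem finrank_matrices {k : ℕ} {ℓ m : Fin k → ℤ} (hℓ : StrictMono ℓ) (hm : StrictMono m) :
    (Module.finrank ℂ ↑((suppOn fun v : Fin k × Fin k => gridB ℓ m v.1 v.2) ⊓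
        LinearMap.ker (diagSum k)) : ℤ) -
      Module.finrank ℂ ((suppOn fun v : Fin k × Fin k => gridA ℓ m v.1 v.2).map (shiftDiff k)) =
    alpha ℓ m + beta ℓ m - k - (Finset.univ.image ℓ ∩ Finset.univ.image m).card := by
  classical
  have h1 := finrank_map_add_finrank_inf_ker (diagSum k)
    (suppOn fun v : Fin k × Fin k => gridB ℓ m v.1 v.2)
  have h2 := finrank_map_add_finrank_inf_ker (shiftDiff k)
    (suppOn fun v : Fin k × Fin k => gridA ℓ m v.1 v.2)
  rw [map_diagSum, finrank_suppOn, finrank_suppOn] at h1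
  rw [suppOn_inf_ker_shiftDiff,
    ← (Submodule.equivMapOfInjective _ toeplitz_injective _).finrank_eq, finrank_suppOn,
    finrank_suppOn] at h2
  have h3 := card_upperDiag_filled (ℓ := ℓ) hm
  have h4 := card_lowerDiag_filled (m := m) hℓ
  have h5 := card_gridA_eq hℓ hm
  omega

/-! ### Setting `y = 1` -/

section

open Polynomial

section Dehomogenization

variable {k : ℕ}

/-- Setting `y = 1`: the vector of the coefficients of `1, x, …, x ^ (k - 1)`. -/
def dehom (k : ℕ) : R k →ₗ[ℂ] (Fin k → ℂ) :=
  LinearMap.pi fun q => Polynomial.leval 1 ∘ₗ (coeffX q).restrictScalars ℂ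

theorem dehom_apply (r : R k) (q : Fin k) : dehom k r q = (coeffX q r).eval 1 := rfl

theorem dehom_y_pow_mul (n : ℕ) (r : R k) : dehom k (y k ^ n * r) = dehom k r := by
  ext q
  rw [dehom_apply, dehom_apply, y_pow_mul, map_smul, smul_eq_mul]
  simp

theorem dehom_x_pow (n : ℕ) (q : Fin k) : dehom k (x k ^ n) q = if n = q then 1 else 0 := by
  rw [dehom_apply, coeffX_x_pow]
  split_ifs <;> simp

theorem dehom_x_pow_mul (n : ℕ) (r : R k) (q : Fin k) :
    dehom k (x k ^ n * r) q = ∑ j : Fin k, if (j : ℕ) + n = q then dehom k r j else 0 := by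
  conv_lhs => rw [← sum_coeffX r]
  simp only [dehom_apply, Finset.mul_sum, mul_smul_comm, ← pow_add, map_sum, map_smul,
    coeffX_x_pow, eval_finsetSum]
  refine Finset.sum_congr rfl fun j _ => ?_
  rw [add_comm n]
  split_ifs <;> simp

theorem x_mem_grading (k : ℕ) : x k ∈ grading k 1 :=
  ⟨MvPolynomial.X 0, MvPolynomial.isWeightedHomogeneous_X ℂ wt 0, rfl⟩

theorem y_mem_grading (k : ℕ) : y k ∈ grading k (-1) :=
  ⟨MvPolynomial.X 1, MvPolynomial.isWeightedHomogeneous_X ℂ wt 1, rfl⟩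

theorem x_pow_mul_y_pow_mem_grading (k i j : ℕ) : x k ^ i * y k ^ j ∈ grading k (i - j) := by
  have h := SetLike.mul_mem_graded (SetLike.pow_mem_graded i (x_mem_grading k))
    (SetLike.pow_mem_graded j (y_mem_grading k))
  simpa [sub_eq_add_neg] using h

theorem monomial_eq (d : Fin 2 →₀ ℕ) (c : ℂ) :
    (Ideal.Quotient.mk _ (MvPolynomial.monomial d c) : R k) =
      (C c * X ^ d 1 : ℂ[X]) • x k ^ d 0 := by
  rw [MvPolynomial.monomial_eq, Finsupp.prod_fintype _ _ (by simp), Fin.prod_univ_two, map_mul,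
    map_mul, map_pow, map_pow, Algebra.smul_def, map_mul, ← y_pow_eq, algebraMap_C]
  change _ * (x k ^ d 0 * y k ^ d 1) = _
  rw [mul_comm (x k ^ d 0), ← mul_assoc]
  rfl

/-- The coefficient of `x ^ q` in an element of degree `n` is a multiple of `y ^ (q - n)`, and it
vanishes if `q < n`. -/
theorem coeffX_of_mem_grading {n : ℤ} {r : R k} (hr : r ∈ grading k n) (q : Fin k) :
    coeffX q r = C (dehom k r q) * X ^ ((q : ℤ) - n).toNat ∧ ((q : ℤ) < n → dehom k r q = 0) := by
  suffices h : ∃ c : ℂ, coeffX q r = C c * X ^ ((q : ℤ) - n).toNat ∧ ((q : ℤ) < n → c = 0) by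
    obtain ⟨c, h1, h2⟩ := h
    have : dehom k r q = c := by
      rw [dehom_apply, h1]
      simp
    rw [this]
    exact ⟨h1, h2⟩
  obtain ⟨p, hp, rfl⟩ := hr
  change ∃ c : ℂ, coeffX q (Ideal.Quotient.mk _ p) = _ ∧ _
  rw [p.as_sum, map_sum, map_sum]
  refine Finset.sum_induction _ (fun s => ∃ c : ℂ, s = C c * X ^ ((q : ℤ) - n).toNat ∧
    ((q : ℤ) < n → c = 0)) ?_ ⟨0, by simp, fun _ => rfl⟩ ?_
  · rintro _ _ ⟨c, rfl, hc⟩ ⟨c', rfl, hc'⟩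
    exact ⟨c + c', by rw [C_add, add_mul], fun h => by rw [hc h, hc' h, add_zero]⟩
  · intro d hd
    have hw : (d 0 : ℤ) - d 1 = n := by
      have h := hp (MvPolynomial.mem_support_iff.1 hd)
      rw [Finsupp.weight_apply, Finsupp.sum_fintype _ _ (by simp), Fin.sum_univ_two] at h
      simpa [wt, sub_eq_add_neg] using h
    rw [monomial_eq, map_smul, coeffX_x_pow]
    split_ifs with h
    · refine ⟨p.coeff d, ?_, fun hq => by omega⟩
      rw [smul_eq_mul, mul_one, show ((q : ℤ) - n).toNat = d 1 by omega]
    · exact ⟨0, by simp, fun _ => rfl⟩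

/-- Setting `y = 1` is injective on each homogeneous part. -/
theorem eq_zero_of_dehom {n : ℤ} {r : R k} (hr : r ∈ grading k n) (h : dehom k r = 0) : r = 0 :=
  eq_of_coeffX fun q => by
    rw [(coeffX_of_mem_grading hr q).1, h]
    simp

end Dehomogenization

section RankOne

variable {k : ℕ} (hk : 0 < k) (ℓ : Fin k → ℤ)

/-- The exponents of `y` in the generators of the ideal of `I(ℓ)`, indexed by the natural numbers
from `0`. The value `0` from `k` on keeps the sequence antitone. -/
def yExp (p : ℕ) : ℕ :=
  if h : p < k then (ℓ ⟨k - 1, by omega⟩ - ℓ ⟨p, h⟩ - (k - 1 - p : ℤ)).toNat else 0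

theorem yExp_coe (p : Fin k) :
    yExp hk ℓ p = (ℓ ⟨k - 1, by omega⟩ - ℓ p - (k - 1 - p : ℤ)).toNat := dif_pos p.2

theorem rankOneIdeal_eq : rankOneIdeal hk ℓ =
    Ideal.span (Set.range fun p : Fin k => x k ^ (p : ℕ) * y k ^ yExp hk ℓ p) := by
  simp only [rankOneIdeal, yExp_coe]

theorem gen_mem (p : Fin k) : x k ^ (p : ℕ) * y k ^ yExp hk ℓ p ∈ rankOneIdeal hk ℓ := by
  rw [rankOneIdeal_eq]
  exact Ideal.subset_span ⟨p, rfl⟩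

/-- The elements of `I(ℓ)` are the elements of the ideal. -/
def toIdeal : rankOne hk ℓ ≃ₗ[R k] rankOneIdeal hk ℓ where
  toFun v := v
  invFun v := v
  map_add' _ _ := rfl
  map_smul' _ _ := rfl

/-- The inclusion of `I(ℓ)` in `R_k`, which shifts the degrees. -/
def incl : rankOne hk ℓ →ₗ[R k] R k := (rankOneIdeal hk ℓ).subtype ∘ₗ (toIdeal hk ℓ).toLinearMap

theorem incl_injective : Function.Injective (incl hk ℓ) :=
  fun _ _ h => (toIdeal hk ℓ).injective (Subtype.ext h)

theorem incl_toIdeal_symm (v : rankOneIdeal hk ℓ) : incl hk ℓ ((toIdeal hk ℓ).symm v) = v := rfl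

theorem incl_mem (v : rankOne hk ℓ) : incl hk ℓ v ∈ rankOneIdeal hk ℓ := (toIdeal hk ℓ v).2

theorem mem_deg_rankOne {n : ℤ} {v : rankOne hk ℓ} :
    v ∈ (rankOne hk ℓ).deg n ↔ incl hk ℓ v ∈ grading k (n + (k - 1 - ℓ ⟨k - 1, by omega⟩)) :=
  Iff.rfl

variable {ℓ}

theorem sub_le_of_strictMono (hℓ : StrictMono ℓ) {p q : Fin k} (h : p ≤ q) :
    (q : ℤ) - p ≤ ℓ q - ℓ p := by
  obtain ⟨n, hn⟩ := Nat.exists_eq_add_of_le (Fin.le_def.1 h)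
  induction n generalizing q with
  | zero =>
    obtain rfl : p = q := Fin.ext (by omega)
    simp
  | succ n ih =>
    have h1 := ih (q := ⟨p + n, by omega⟩) (Fin.le_def.2 (by simp)) rfl
    have h2 := hℓ (show (⟨p + n, by omega⟩ : Fin k) < q from Fin.lt_def.2 (by simp only; omega))
    simp only at h1
    omega

theorem coe_yExp (hℓ : StrictMono ℓ) (p : Fin k) :
    (yExp hk ℓ p : ℤ) = ℓ ⟨k - 1, by omega⟩ - ℓ p - (k - 1 - p : ℤ) := by
  have h := sub_le_of_strictMono hℓ (show p ≤ ⟨k - 1, by omega⟩ from Fin.le_def.2 (by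
    simp only; omega))
  simp only at h
  rw [yExp_coe, Int.toNat_of_nonneg]
  omega

theorem yExp_antitone (hℓ : StrictMono ℓ) : Antitone (yExp hk ℓ) := by
  refine antitone_nat_of_succ_le fun p => ?_
  by_cases hp : p + 1 < k
  · have h1 := coe_yExp hk hℓ ⟨p, by omega⟩
    have h2 := coe_yExp hk hℓ ⟨p + 1, hp⟩
    have h3 := hℓ (show (⟨p, by omega⟩ : Fin k) < ⟨p + 1, hp⟩ from Fin.lt_def.2 (by simp))
    simp only at h1 h2
    push_cast at h2
    omega
  · rw [yExp, dif_neg hp]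
    exact Nat.zero_le _

/-- In the ideal of `I(ℓ)` the coefficient of `x ^ q` is divisible by the power of `y` in the `q`-th
generator. -/
theorem X_pow_dvd_of_mem (hℓ : StrictMono ℓ) {v : R k} (hv : v ∈ rankOneIdeal hk ℓ) (q : Fin k) :
    X ^ yExp hk ℓ q ∣ coeffX q v := by
  rw [rankOneIdeal_eq] at hv
  obtain ⟨f, rfl⟩ := (Submodule.mem_span_range_iff_exists_fun _).1 hv
  rw [map_sum]
  refine Finset.dvd_sum fun p _ => ?_
  rw [smul_eq_mul, ← sum_coeffX (f p), Finset.sum_mul, map_sum]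
  refine Finset.dvd_sum fun i _ => ?_
  have : coeffX i (f p) • x k ^ (i : ℕ) * (x k ^ (p : ℕ) * y k ^ yExp hk ℓ p) =
      (coeffX i (f p) * X ^ yExp hk ℓ p) • x k ^ (i + p : ℕ) := by
    rw [Algebra.smul_def, Algebra.smul_def, map_mul, ← y_pow_eq]
    ring
  rw [this, map_smul, coeffX_x_pow, smul_eq_mul]
  split_ifs with h
  · rw [mul_one]
    exact Dvd.dvd.mul_left (pow_dvd_pow _ (yExp_antitone hk hℓ (by omega))) _
  · simp

/-- Setting `y = 1` in a homogeneous element of degree `n` of `I(ℓ)` gives a vector that is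
supported where `n ≤ ℓ q`. -/
theorem dehom_eq_zero_of_mem_deg (hℓ : StrictMono ℓ) {n : ℤ} {v : rankOne hk ℓ}
    (hv : v ∈ (rankOne hk ℓ).deg n) (q : Fin k) (hq : ¬ n ≤ ℓ q) : dehom k (incl hk ℓ v) q = 0 := by
  rw [mem_deg_rankOne] at hv
  obtain ⟨h1, h2⟩ := coeffX_of_mem_grading hv q
  by_contra hne
  have h3 : ¬ ((q : ℤ) < n + (k - 1 - ℓ ⟨k - 1, by omega⟩)) := fun h => hne (h2 h)
  have h4 := X_pow_dvd_of_mem hk hℓ (incl_mem hk ℓ v) q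
  rw [h1] at h4
  have h5 : yExp hk ℓ q ≤ ((q : ℤ) - (n + (k - 1 - ℓ ⟨k - 1, by omega⟩))).toNat := by
    have h6 := (IsUnit.dvd_mul_left (isUnit_C.2 (isUnit_iff_ne_zero.2 hne))).1 h4
    exact (pow_dvd_pow_iff X_ne_zero not_isUnit_X).1 h6
  have h7 := coe_yExp hk hℓ q
  omega

/-- Every vector that is supported where `n ≤ ℓ q` comes from an element of degree `n`. -/
theorem exists_mem_deg (hℓ : StrictMono ℓ) (n : ℤ) (c : Fin k → ℂ) (hc : ∀ q, ¬ n ≤ ℓ q → c q = 0) :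
    ∃ v : rankOne hk ℓ, v ∈ (rankOne hk ℓ).deg n ∧ dehom k (incl hk ℓ v) = c := by
  let g (q : Fin k) : R k := y k ^ (ℓ q - n).toNat * (x k ^ (q : ℕ) * y k ^ yExp hk ℓ q)
  have h1 : ∑ q : Fin k, c q • g q ∈ rankOneIdeal hk ℓ := sum_mem fun q _ => by
    have h (v : R k) : c q • v = algebraMap ℂ (R k) (c q) * v := Algebra.smul_def (c q) v
    rw [h]
    exact Ideal.mul_mem_left _ _ (Ideal.mul_mem_left _ _ (gen_mem hk ℓ q))
  have h2 : ∑ q : Fin k, c q • g q ∈ grading k (n + (k - 1 - ℓ ⟨k - 1, by omega⟩)) :=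
    sum_mem fun q _ => by
      by_cases hq : n ≤ ℓ q
      · refine Submodule.smul_mem _ _ ?_
        have h := x_pow_mul_y_pow_mem_grading k q ((ℓ q - n).toNat + yExp hk ℓ q)
        have h7 := coe_yExp hk hℓ q
        rw [show ((q : ℕ) : ℤ) - ((ℓ q - n).toNat + yExp hk ℓ q : ℕ) =
          n + (k - 1 - ℓ ⟨k - 1, by omega⟩) by push_cast; omega] at h
        convert h using 1
        ring
      · have h : (0 : ℂ) • g q = 0 := zero_smul ℂ _
        rw [hc q hq, h]
        exact zero_mem _
  refine ⟨(toIdeal hk ℓ).symm ⟨_, h1⟩, h2, ?_⟩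
  rw [incl_toIdeal_symm]
  ext s
  simp only [g, map_sum, map_smul, dehom_y_pow_mul, Finset.sum_apply, Pi.smul_apply]
  rw [Finset.sum_eq_single s]
  · rw [mul_comm, dehom_y_pow_mul, dehom_x_pow, if_pos rfl, smul_eq_mul, mul_one]
  · intro q _ hq
    rw [mul_comm, dehom_y_pow_mul, dehom_x_pow, if_neg (fun h => hq (Fin.ext h)), smul_zero]
  · simp

end RankOne

end

/-! ### The module of relations and its morphisms -/

section

open Polynomial

section Presentation

/-- The equation between the images of the relations, with `y` set to `1`. -/
theorem dehom_sum {k : ℕ} (t : Fin k → R k) (a : Fin k → ℕ) :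
    dehom k (∑ p : Fin k, x k ^ (k - 1 - p : ℕ) * y k ^ a p * t p) =
      diagSum k fun v => dehom k (t v.1) v.2 := by
  ext r
  rw [map_sum, Finset.sum_apply, diagSum_apply]
  refine Finset.sum_congr rfl fun p _ => ?_
  rw [mul_assoc, dehom_x_pow_mul]
  simp only [dehom_y_pow_mul]

/-- The elements of a graded free module are vectors. -/
def toVec {k : ℕ} (d : Fin k → ℤ) : GrMod.free (grading k) d ≃ₗ[R k] (Fin k → R k) where
  toFun v := v
  invFun v := v
  map_add' _ _ := rfl
  map_smul' _ _ := rfl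

theorem toVec_freeGen {k : ℕ} (d : Fin k → ℤ) (p : Fin k) :
    toVec d (GrMod.freeGen p) = eps (R k) k p := by
  change (Pi.single p 1 : Fin k → R k) = _
  ext i
  simp only [Pi.single_apply, eps, Fin.ext_iff]

theorem toVec_symm_eq {k : ℕ} (d : Fin k → ℤ) (f : Fin k → R k) :
    (toVec d).symm f = ∑ p, f p • GrMod.freeGen p := by
  rw [LinearEquiv.symm_apply_eq, map_sum]
  simp only [map_smul, toVec_freeGen, sum_smul_eps]

variable {k : ℕ} (hk : 0 < k) {ℓ : Fin k → ℤ} (hℓ : StrictMono ℓ)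

/-- The generators of `I(ℓ)`. -/
def gen (ℓ : Fin k → ℤ) (p : Fin k) : rankOne hk ℓ :=
  (toIdeal hk ℓ).symm ⟨x k ^ (p : ℕ) * y k ^ yExp hk ℓ p, gen_mem hk ℓ p⟩

include hℓ

theorem gen_mem_deg (p : Fin k) : gen hk ℓ p ∈ (rankOne hk ℓ).deg (ℓ p) := by
  rw [mem_deg_rankOne, gen, incl_toIdeal_symm]
  have h := x_pow_mul_y_pow_mem_grading k p (yExp hk ℓ p)
  have h' := coe_yExp hk hℓ p
  rwa [show ((p : ℕ) : ℤ) - (yExp hk ℓ p : ℕ) = ℓ p + (k - 1 - ℓ ⟨k - 1, by omega⟩) by omega] at h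

/-- The presentation of `I(ℓ)` by the graded free module on generators of degrees `ℓ_p`. -/
def cover : GrMod.free (grading k) ℓ ⟶ rankOne hk ℓ :=
  GrMod.freeLift (gen hk ℓ) (gen_mem_deg hk hℓ)

theorem incl_cover (v : GrMod.free (grading k) ℓ) :
    incl hk ℓ ((cover hk hℓ).lin v) = combination (yExp hk ℓ) k (toVec ℓ v) := by
  obtain ⟨f, rfl⟩ := (toVec ℓ).symm.surjective v
  rw [LinearEquiv.apply_symm_apply, toVec_symm_eq, combination_apply, map_sum, map_sum]
  refine Finset.sum_congr rfl fun p _ => ?_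
  rw [map_smul, map_smul, cover, GrMod.freeLift_freeGen, gen, incl_toIdeal_symm, smul_eq_mul]

theorem cover_surjective : Function.Surjective (cover hk hℓ).lin := by
  intro v
  have hv := incl_mem hk ℓ v
  rw [rankOneIdeal_eq] at hv
  obtain ⟨f, hf⟩ := (Submodule.mem_span_range_iff_exists_fun _).1 hv
  exact ⟨(toVec ℓ).symm f, incl_injective hk ℓ ((incl_cover hk hℓ _).trans hf)⟩

/-- The module of relations between the generators of `I(ℓ)`. -/
abbrev relModule : GrMod (grading k) := GrMod.ker (cover hk hℓ)

/-- The module of relations as the kernel of an explicit linear map. -/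
def toKer : relModule hk hℓ ≃ₗ[R k] LinearMap.ker (combination (yExp hk ℓ) k) where
  toFun v := ⟨toVec ℓ v.1, by
    rw [LinearMap.mem_ker, ← incl_cover hk hℓ]
    exact (congrArg (incl hk ℓ) v.2).trans (map_zero _)⟩
  invFun v := ⟨(toVec ℓ).symm v.1, incl_injective hk ℓ (by
    rw [incl_cover hk hℓ, map_zero]
    exact v.2)⟩
  map_add' _ _ := rfl
  map_smul' _ _ := rfl

theorem relation_mem_deg (p : Fin k) (i : Fin k) :
    relation (x k) (y k) (yExp hk ℓ) k p i ∈ grading k (ℓ p + 1 - ℓ i) := by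
  refine sub_mem ?_ ?_
  · simp only [Pi.smul_apply, eps, smul_eq_mul, mul_ite, mul_one, mul_zero]
    split_ifs with h
    · obtain rfl : i = p := Fin.ext h
      rw [add_sub_cancel_left]
      exact x_mem_grading k
    · exact zero_mem _
  · simp only [Pi.smul_apply, eps, smul_eq_mul, mul_ite, mul_one, mul_zero]
    split_ifs with h
    · have h0 := x_pow_mul_y_pow_mem_grading k 0 (yExp hk ℓ p - yExp hk ℓ (p + 1))
      rw [pow_zero, one_mul] at h0
      have h1 := coe_yExp hk hℓ p
      have h2 := coe_yExp hk hℓ i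
      rw [h] at h2
      have h3 := yExp_antitone hk hℓ (Nat.le_succ p)
      simp only [Nat.succ_eq_add_one] at h3
      rwa [show ((0 : ℕ) : ℤ) - (yExp hk ℓ p - yExp hk ℓ (p + 1) : ℕ) = ℓ p + 1 - ℓ i by
        push_cast [h3]; omega] at h0
    · exact zero_mem _

/-- The generating relations of `I(ℓ)` as elements of the module of relations. -/
def rel (p : Fin k) : relModule hk hℓ :=
  (toKer hk hℓ).symm ⟨relation (x k) (y k) (yExp hk ℓ) k p,
    combination_relation (yExp_antitone hk hℓ) p⟩

theorem rel_mem_deg (p : Fin k) : rel hk hℓ p ∈ (relModule hk hℓ).deg (ℓ p + 1) :=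
  fun i _ => relation_mem_deg hk hℓ p i

theorem span_rel : Submodule.span (R k) (Set.range (rel hk hℓ)) = ⊤ := by
  rw [eq_top_iff]
  intro v _
  obtain ⟨w, rfl⟩ := (toKer hk hℓ).symm.surjective v
  have hw := (ker_combination (yExp_antitone hk hℓ)).le w.2
  obtain ⟨f, hf⟩ := (Submodule.mem_span_range_iff_exists_fun _).1 hw
  have h : w = ∑ p : Fin k, f p • ⟨relation (x k) (y k) (yExp hk ℓ) k p,
      combination_relation (yExp_antitone hk hℓ) p⟩ := Subtype.ext (by
    rw [← hf, AddSubmonoidClass.coe_finsetSum]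
    rfl)
  rw [h, map_sum]
  refine sum_mem fun p _ => ?_
  rw [map_smul]
  exact Submodule.smul_mem _ _ (Submodule.subset_span ⟨p, rfl⟩)

/-- The graded free cover of the module of relations. -/
def relCover : GrMod.free (grading k) (fun p => ℓ p + 1) ⟶ relModule hk hℓ :=
  GrMod.freeLift (rel hk hℓ) (rel_mem_deg hk hℓ)

theorem relCover_surjective : Function.Surjective (relCover hk hℓ).lin := by
  rw [← LinearMap.range_eq_top, eq_top_iff, ← span_rel, Submodule.span_le]
  rintro _ ⟨p, rfl⟩
  exact ⟨GrMod.freeGen p, GrMod.freeLift_freeGen _ _ p⟩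

theorem sum_rel : ∑ p : Fin k, (x k ^ (k - 1 - p : ℕ) * y k ^ (yExp hk ℓ 0 - yExp hk ℓ p)) •
    rel hk hℓ p = 0 := by
  have h := sum_relation (x k) (y k) (yExp_antitone hk hℓ) (x_pow_self k)
  rw [Finset.sum_range] at h
  apply (toKer hk hℓ).injective
  rw [map_sum, map_zero]
  refine Subtype.ext ?_
  rw [AddSubmonoidClass.coe_finsetSum]
  exact h

variable {m : Fin k → ℤ} (hm : StrictMono m)

/-- The matrix of a morphism from the module of relations of `I(ℓ)` to `I(m)`: its row `p` is the
image of the `p`-th relation with `y` set to `1`. -/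
def matrixOf (m : Fin k → ℤ) :
    (relModule hk hℓ ⟶ rankOne hk m) →ₗ[ℂ] (Fin k × Fin k → ℂ) where
  toFun φ v := dehom k (incl hk m (φ.lin (rel hk hℓ v.1))) v.2
  map_add' φ ψ := by
    ext v
    rw [Pi.add_apply, ← Pi.add_apply, ← map_add, ← map_add]
    rfl
  map_smul' c φ := by
    ext v
    rw [RingHom.id_apply, Pi.smul_apply, ← Pi.smul_apply, ← map_smul, GrMod.smul_lin,
      LinearMap.smul_apply, map_smul]
    exact congrFun (congrArg (dehom k)
      (Algebra.smul_def c (incl hk m (φ.lin (rel hk hℓ v.1)))).symm) v.2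

theorem matrixOf_apply (φ : relModule hk hℓ ⟶ rankOne hk m) (p q : Fin k) :
    matrixOf hk hℓ m φ (p, q) = dehom k (incl hk m (φ.lin (rel hk hℓ p))) q := rfl

theorem matrixOf_injective : Function.Injective (matrixOf hk hℓ m) := by
  rw [injective_iff_map_eq_zero]
  intro φ hφ
  have h (p : Fin k) : φ.lin (rel hk hℓ p) = 0 := by
    have hd := φ.map_deg _ _ (rel_mem_deg hk hℓ p)
    rw [mem_deg_rankOne] at hd
    refine incl_injective hk m ((eq_zero_of_dehom hd ?_).trans (map_zero _).symm)
    ext q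
    exact congrFun hφ (p, q)
  refine GrMod.lin_injective (LinearMap.ext_on_range (span_rel hk hℓ) fun p => ?_)
  rw [h]
  rfl

theorem kerι_rel (p : Fin k) : (GrMod.kerι (cover hk hℓ)).lin (rel hk hℓ p) =
    x k • GrMod.freeGen p - ∑ i : Fin k, if (i : ℕ) = p + 1 then
      y k ^ (yExp hk ℓ p - yExp hk ℓ (p + 1)) • GrMod.freeGen i else 0 := by
  apply (toVec ℓ).injective
  rw [map_sub, map_smul, toVec_freeGen, map_sum]
  change relation (x k) (y k) (yExp hk ℓ) k p = _
  rw [relation]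
  congr 1
  by_cases hp : (p : ℕ) + 1 < k
  · rw [Finset.sum_eq_single ⟨p + 1, hp⟩, if_pos rfl, map_smul, toVec_freeGen]
    · intro i _ hi
      rw [if_neg fun h => hi (Fin.ext h), map_zero]
    · simp
  · rw [eps_of_le (by omega), smul_zero, Finset.sum_eq_zero]
    intro i _
    rw [if_neg (by omega), map_zero]

theorem matrixOf_kerι_comp (Φ : GrMod.free (grading k) ℓ ⟶ rankOne hk m) :
    matrixOf hk hℓ m (GrMod.kerι (cover hk hℓ) ≫ Φ) = shiftDiff k fun v =>
      dehom k (incl hk m (Φ.lin (GrMod.freeGen v.1))) v.2 := by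
  ext ⟨p, q⟩
  rw [matrixOf_apply, GrMod.comp_lin, LinearMap.comp_apply, kerι_rel hk hℓ, shiftDiff_apply,
    map_sub, map_sub, map_sub, Pi.sub_apply]
  congr 1
  · rw [map_smul, map_smul, smul_eq_mul, ← pow_one (x k), dehom_x_pow_mul]
  · rw [map_sum, map_sum, map_sum, Finset.sum_apply]
    refine Finset.sum_congr rfl fun i _ => ?_
    split_ifs
    · rw [map_smul, map_smul, smul_eq_mul, dehom_y_pow_mul]
    · simp

include hm

/-- A matrix describes a morphism from the module of relations if and only if it is supported in
`B(ℓ, m)` and its sums along the lower diagonals vanish. -/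
theorem range_matrixOf : LinearMap.range (matrixOf hk hℓ m) =
    (suppOn fun v : Fin k × Fin k => gridB ℓ m v.1 v.2) ⊓ LinearMap.ker (diagSum k) := by
  apply le_antisymm
  · rintro _ ⟨φ, rfl⟩
    refine ⟨fun v hv => ?_, ?_⟩
    · refine dehom_eq_zero_of_mem_deg hk hm (φ.map_deg _ _ (rel_mem_deg hk hℓ v.1)) v.2 ?_
      intro h
      exact hv (Int.lt_iff_add_one_le.2 h)
    · have h := congrArg (fun v => incl hk m (φ.lin v)) (sum_rel hk hℓ)
      simp only [map_sum, map_smul, map_zero] at h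
      refine LinearMap.mem_ker.2 ?_
      refine (dehom_sum (fun p => incl hk m (φ.lin (rel hk hℓ p)))
        (fun p => yExp hk ℓ 0 - yExp hk ℓ p)).symm.trans ?_
      exact (congrArg (dehom k) h).trans (map_zero _)
  · rintro θ ⟨hθ, hθ'⟩
    choose t ht hdt using fun p => exists_mem_deg hk hm (ℓ p + 1) (fun q => θ (p, q))
      (fun q hq => hθ _ fun h => hq (Int.add_one_le_of_lt h))
    have h0 : ∑ p : Fin k, x k ^ (k - 1 - p : ℕ) * y k ^ (yExp hk ℓ 0 - yExp hk ℓ p) *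
        incl hk m (t p) = 0 := by
      refine eq_zero_of_dehom (n := ℓ ⟨0, hk⟩ + k + (k - 1 - m ⟨k - 1, by omega⟩))
        (sum_mem fun p _ => ?_) ?_
      · have h1 := SetLike.mul_mem_graded (x_pow_mul_y_pow_mem_grading k (k - 1 - p)
          (yExp hk ℓ 0 - yExp hk ℓ p)) ((mem_deg_rankOne hk m).1 (ht p))
        have h2 := coe_yExp hk hℓ p
        have h3 := coe_yExp hk hℓ ⟨0, hk⟩
        have h4 := yExp_antitone hk hℓ (Nat.zero_le p)
        simp only at h3
        convert h1 using 2
        push_cast [h4]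
        omega
      · rw [dehom_sum]
        simp only [hdt]
        exact hθ'
    obtain ⟨φ, hφ⟩ := exists_linearMap_ker (yExp_antitone hk hℓ) (rankOneIdeal hk m)
      (fun p => toIdeal hk m (t p)) h0
    let φ' : relModule hk hℓ →ₗ[R k] rankOne hk m :=
      (toIdeal hk m).symm.toLinearMap ∘ₗ φ ∘ₗ (toKer hk hℓ).toLinearMap
    have hφ' (p : Fin k) : φ' (rel hk hℓ p) = t p := congrArg (toIdeal hk m).symm (hφ p)
    let ψ : GrMod.free (grading k) (fun p => ℓ p + 1) ⟶ rankOne hk m := GrMod.freeLift t ht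
    have hψ (v : GrMod.free (grading k) (fun p => ℓ p + 1)) :
        φ' ((relCover hk hℓ).lin v) = ψ.lin v := by
      obtain ⟨f, rfl⟩ := (toVec _).symm.surjective v
      rw [toVec_symm_eq]
      simp only [map_sum, map_smul, relCover, ψ, GrMod.freeLift_freeGen, hφ']
    let Φ : relModule hk hℓ ⟶ rankOne hk m :=
      ⟨φ', GrMod.map_deg_of_surjective (relCover hk hℓ) (relCover_surjective hk hℓ) φ'
        (fun n v hv => by
          rw [hψ]
          exact ψ.map_deg n v hv)⟩
    refine ⟨Φ, ?_⟩
    ext ⟨p, q⟩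
    rw [matrixOf_apply]
    refine Eq.trans ?_ (congrFun (hdt p) q)
    exact congrArg (fun v => dehom k (incl hk m v) q) (hφ' p)

/-- The dimension of the Yoneda `Ext¹` of graded modules. -/
theorem finrank_ext : Module.Finite ℂ (Abelian.Ext (rankOne hk ℓ) (rankOne hk m) 1) ∧
    (Module.finrank ℂ (Abelian.Ext (rankOne hk ℓ) (rankOne hk m) 1) : ℤ) =
      alpha ℓ m + beta ℓ m - k - (Finset.univ.image ℓ ∩ Finset.univ.image m).card := by
  have hS := GrMod.shortExact_ker _ (cover_surjective hk hℓ)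
  have : Projective (ShortComplex.mk _ _ (GrMod.kerι_comp (cover hk hℓ))).X₂ :=
    inferInstanceAs (Projective (GrMod.free (grading k) ℓ))
  let δ : (GrMod.ker (cover hk hℓ) ⟶ rankOne hk m) →ₗ[ℂ]
    Abelian.Ext (rankOne hk ℓ) (rankOne hk m) 1 := connecting hS (rankOne hk m)
  have hδ : Function.Surjective δ := connecting_surjective hS (rankOne hk m)
  have hfin : Module.Finite ℂ (GrMod.ker (cover hk hℓ) ⟶ rankOne hk m) :=
    Module.Finite.of_injective _ (matrixOf_injective hk hℓ)
  have hker : (LinearMap.ker δ).map (matrixOf hk hℓ m) =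
      (suppOn fun v : Fin k × Fin k => gridA ℓ m v.1 v.2).map (shiftDiff k) := by
    ext θ
    constructor
    · rintro ⟨φ, hφ, rfl⟩
      obtain ⟨Φ, rfl⟩ := (connecting_eq_zero_iff hS φ).1 hφ
      refine ⟨_, fun v hv => ?_, (matrixOf_kerι_comp hk hℓ Φ).symm⟩
      exact dehom_eq_zero_of_mem_deg hk hm (Φ.map_deg _ _ (GrMod.freeGen_mem_deg v.1)) v.2 hv
    · rintro ⟨h, hh, rfl⟩
      choose t ht hdt using fun p => exists_mem_deg hk hm (ℓ p) (fun q => h (p, q))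
        (fun q hq => hh _ hq)
      refine ⟨GrMod.kerι (cover hk hℓ) ≫ GrMod.freeLift t ht,
        (connecting_eq_zero_iff hS _).2 ⟨_, rfl⟩, ?_⟩
      rw [matrixOf_kerι_comp]
      congr 1
      ext ⟨p, q⟩
      rw [GrMod.freeLift_freeGen, hdt]
  refine ⟨Module.Finite.of_surjective _ hδ, ?_⟩
  have h1 := LinearMap.finrank_range_add_finrank_ker δ
  rw [LinearMap.range_eq_top.2 hδ, finrank_top,
    (Submodule.equivMapOfInjective _ (matrixOf_injective hk hℓ) (LinearMap.ker δ)).finrank_eq,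
    (LinearEquiv.ofInjective _ (matrixOf_injective hk hℓ (m := m))).finrank_eq, hker,
    range_matrixOf hk hℓ hm] at h1
  rw [← finrank_matrices hℓ hm, ← h1]
  push_cast
  ring

end Presentation

end

end

end GrassmannianCategory

/-- `k`-subsets `ℓ`, `m` of `ℤ` are viewed as their strictly increasing enumerations. -/
theorem theorem4p12 (k : ℕ) (hk : 2 ≤ k) (ℓ m : Finset ℤ) (hℓ : ℓ.card = k) (hm : m.card = k) :
    let lt : Fin k → ℤ := ℓ.orderEmbOfFin hℓ
    let mt : Fin k → ℤ := m.orderEmbOfFin hm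
    let I := GrassmannianCategory.rankOne (by omega) lt
    let J := GrassmannianCategory.rankOne (by omega) mt
    GrassmannianCategory.IsMCM I ∧ GrassmannianCategory.IsMCM J ∧
      Module.Finite ℂ (GrassmannianCategory.ExtMCM I J) ∧
      (Module.finrank ℂ (GrassmannianCategory.ExtMCM I J) : ℤ) =
        GrassmannianCategory.alpha lt mt + GrassmannianCategory.beta lt mt - k -
          (ℓ ∩ m).card := by
  intro lt mt I J
  have hk' : 0 < k := by omega
  have hlt : StrictMono lt := (ℓ.orderEmbOfFin hℓ).strictMono
  have hmt : StrictMono mt := (m.orderEmbOfFin hm).strictMono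
  have hI : GrassmannianCategory.IsMCM I := GrassmannianCategory.isMCM_rankOne hk' lt
  have hJ : GrassmannianCategory.IsMCM J := GrassmannianCategory.isMCM_rankOne hk' mt
  have hℓ' : Finset.univ.image lt = ℓ := Finset.image_orderEmbOfFin_univ ℓ hℓ
  have hm' : Finset.univ.image mt = m := Finset.image_orderEmbOfFin_univ m hm
  obtain ⟨h1, h2⟩ := GrassmannianCategory.finrank_ext hk' hlt hmt
  rw [hℓ', hm'] at h2
  have htop : GrassmannianCategory.ExtMCM I J = ⊤ :=
    GrassmannianCategory.extMCM_eq_top hI hJ (GrassmannianCategory.cover hk' hlt)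
      (GrassmannianCategory.cover_surjective hk' hlt)
  refine ⟨hI, hJ, ?_, ?_⟩
  · rw [htop]
    have : Module.Finite ℂ (CategoryTheory.Abelian.Ext I J 1) := h1
    exact Module.Finite.equiv Submodule.topEquiv.symm
  · rw [htop, finrank_top]
    exact h2
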